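/- Let $q\in\mathbb{C}^\times$ be a root of unity with $\delta=q+q^{-1}\ge 0$, let $l$ be the least positive integer with $q^{2l}=1$, and assume $l\ge 2$. Let $TL_\infty=\bigcup_n TL_n$ be the infinite Temperley–Lieb algebra over $\mathbb{C}$ with loop parameter $\delta$: it has generators $e_1,e_2,\dots$ and relations $e_i^2=\delta e_i$, $e_ie_{i\pm1}e_i=e_i$, $e_ie_j=e_je_i$ for $|i-j|>1$, and $TL_n$ is generated by $e_1,\dots,e_{n-1}$. Let $*$ be the conjugate-linear antiautomorphism with $e_i^*=e_i$ (reflection of diagrams). For $2i\le n$ let $t_{n,i}$ be the matrix trace of the standard representation $\mathcal V_{n,i}$ of $TL_n$ on link states with $n$ points and $i$ cups. For $\gamma\in\mathbb{C}$ put $c_{0,0}=c_{1,0}=1$, $c_{n,0}=c_{n-1,0}-\gamma c_{n-2,0}$ and $c_{n,i}=\gamma^i c_{n-2i,0}$, and let $\chi=\chi_{\infty,l}$ be the (extremal) trace on $TL_\infty$ with parameter $\gamma$, that is, the linear functional whose restriction to $TL_n$ is $\sum_{0\le i\le n/2}c_{n,i}t_{n,i}$ for every $n$. Put $\langle x,y\rangle=\chi(xy^*)$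 and $\|x\|^2=\langle x,x\rangle$. Call this form indefinite if $\{x:\|x\|^2=0\}$ is non-empty and not closed under addition. Let $[0]=0$, $[1]=1$, $[k]=\delta[k-1]-[k-2]$, and let $f_n$ be the Jones–Wenzl idempotents: $f_1=1$, $f_{n+1}=f_n-\frac{[n]}{[n+1]}f_ne_nf_n$. Suppose that $\gamma\ne 0$ and $\delta^2\gamma\neq 1$ (that is, $\gamma\ne\delta^{-2}$, a condition that is void if $\delta=0$). Then: 1. The form $\langle\cdot,\cdot\rangle$ on $TL_\infty$ is indefinite. 2. The elements $x=(f_{l-1}\otimes 1\otimes 1)\,e_{l-1}$ and $y=(1\otimes 1\otimes f_{l-1})\,e_2e_3\cdots e_l$ of $TL_{l+1}$ satisfy $$\|x\|^2=\|y\|^2=0,\qquad \|x+y\|^2=\frac{2(-1)^l}{[l-1]}\,c_{l+1,1},$$ and $\|x+y\|^2\neq 0$ if $\gamma$ is real with $0<\gamma\le\frac14$. 3. If $\delta=0$, then $\|e_1\|^2=\|e_2\|^2=0$ and $\|e_1+e_2\|^2=2\gamma$. -/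

import Mathlib

namespace TemperleyLieb

/-! ### The algebra and its involution -/

/-- The Temperley-Lieb relations with loop parameter `δ`. The free generator `i : ℕ` stands for the
diagram generator joining the strands `i + 1` and `i + 2`, classically written `e_{i+1}`. -/
inductive Rel (δ : ℝ) : FreeAlgebra ℂ ℕ → FreeAlgebra ℂ ℕ → Prop
  | sq (i : ℕ) : Rel δ (FreeAlgebra.ι ℂ i * FreeAlgebra.ι ℂ i) ((δ : ℂ) • FreeAlgebra.ι ℂ i)
  | up (i : ℕ) : Rel δ (FreeAlgebra.ι ℂ i * FreeAlgebra.ι ℂ (i + 1) * FreeAlgebra.ι ℂ i)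
      (FreeAlgebra.ι ℂ i)
  | down (i : ℕ) : Rel δ (FreeAlgebra.ι ℂ (i + 1) * FreeAlgebra.ι ℂ i * FreeAlgebra.ι ℂ (i + 1))
      (FreeAlgebra.ι ℂ (i + 1))
  | comm (i j : ℕ) (h : i + 1 < j) : Rel δ (FreeAlgebra.ι ℂ i * FreeAlgebra.ι ℂ j)
      (FreeAlgebra.ι ℂ j * FreeAlgebra.ι ℂ i)

/-- The infinite Temperley-Lieb algebra `TL_∞(δ)`. -/
abbrev TLInf (δ : ℝ) : Type := RingQuot (Rel δ)

/-- The generators: `e δ i` is the classical `e_{i+1}`. -/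
def e (δ : ℝ) (i : ℕ) : TLInf δ := RingQuot.mkAlgHom ℂ (Rel δ) (FreeAlgebra.ι ℂ i)

theorem e_sq (δ : ℝ) (i : ℕ) : e δ i * e δ i = (δ : ℂ) • e δ i := by
  unfold e
  rw [← map_mul, ← map_smul]
  exact RingQuot.mkAlgHom_rel ℂ (Rel.sq i)

theorem e_up (δ : ℝ) (i : ℕ) : e δ i * e δ (i + 1) * e δ i = e δ i := by
  simpa [e] using RingQuot.mkAlgHom_rel ℂ (Rel.up (δ := δ) i)

theorem e_down (δ : ℝ) (i : ℕ) : e δ (i + 1) * e δ i * e δ (i + 1) = e δ (i + 1) := by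
  simpa [e] using RingQuot.mkAlgHom_rel ℂ (Rel.down (δ := δ) i)

theorem e_comm (δ : ℝ) (i j : ℕ) (h : i + 1 < j) : e δ i * e δ j = e δ j * e δ i := by
  simpa [e] using RingQuot.mkAlgHom_rel ℂ (Rel.comm (δ := δ) i j h)

/-- The finite algebra `TL_n(δ)` inside `TL_∞(δ)`: generated by `e_1, …, e_{n-1}`. -/
def TLn (δ : ℝ) (n : ℕ) : Subalgebra ℂ (TLInf δ) :=
  Algebra.adjoin ℂ {x | ∃ i : ℕ, i + 1 < n ∧ x = e δ i}

theorem e_mem (δ : ℝ) {i n : ℕ} (h : i + 1 < n) : e δ i ∈ TLn δ n :=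
  Algebra.subset_adjoin ⟨i, h, rfl⟩

theorem TLn_mono (δ : ℝ) {m n : ℕ} (h : m ≤ n) : TLn δ m ≤ TLn δ n :=
  Algebra.adjoin_mono (by rintro x ⟨i, hi, rfl⟩; exact ⟨i, by omega, rfl⟩)

theorem exists_mem_TLn (δ : ℝ) (x : TLInf δ) : ∃ n, x ∈ TLn δ n := by
  obtain ⟨y, rfl⟩ := RingQuot.mkAlgHom_surjective ℂ (Rel δ) x
  induction y using FreeAlgebra.induction with
  | grade0 r => exact ⟨0, by rw [AlgHom.commutes]; exact Subalgebra.algebraMap_mem _ r⟩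
  | grade1 i => exact ⟨i + 2, e_mem δ (by omega)⟩
  | mul a b ha hb =>
    obtain ⟨n, hn⟩ := ha
    obtain ⟨k, hk⟩ := hb
    refine ⟨max n k, ?_⟩
    rw [map_mul]
    exact mul_mem (TLn_mono δ (le_max_left n k) hn) (TLn_mono δ (le_max_right n k) hk)
  | add a b ha hb =>
    obtain ⟨n, hn⟩ := ha
    obtain ⟨k, hk⟩ := hb
    refine ⟨max n k, ?_⟩
    rw [map_add]
    exact add_mem (TLn_mono δ (le_max_left n k) hn) (TLn_mono δ (le_max_right n k) hk)

/-- The opposite algebra with the conjugate scalar action, an auxiliary type for the involution. -/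
def ConjOp (δ : ℝ) : Type := (TLInf δ)ᵐᵒᵖ

instance (δ : ℝ) : Ring (ConjOp δ) := inferInstanceAs (Ring (TLInf δ)ᵐᵒᵖ)

instance (δ : ℝ) : Algebra ℂ (ConjOp δ) :=
  ((algebraMap ℂ (TLInf δ)ᵐᵒᵖ).comp (starRingEnd ℂ)).toAlgebra'
    (fun c x => Algebra.commutes (A := (TLInf δ)ᵐᵒᵖ) (starRingEnd ℂ c) x)

/-- The identity map to the auxiliary type. -/
def toConjOp (δ : ℝ) (x : TLInf δ) : ConjOp δ := MulOpposite.op x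

/-- The inverse of `toConjOp`. -/
def ofConjOp (δ : ℝ) (x : ConjOp δ) : TLInf δ := MulOpposite.unop (α := TLInf δ) x

theorem toConjOp_mul (δ : ℝ) (x y : TLInf δ) :
    toConjOp δ x * toConjOp δ y = toConjOp δ (y * x) := rfl

theorem smul_toConjOp (δ : ℝ) (c : ℂ) (x : TLInf δ) :
    c • toConjOp δ x = toConjOp δ ((starRingEnd ℂ c) • x) := by
  rw [Algebra.smul_def, Algebra.smul_def, Algebra.commutes (starRingEnd ℂ c) x]
  rfl

/-- Diagram reflection, extended conjugate-linearly, as a homomorphism to the opposite algebra. -/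
def reflectHom (δ : ℝ) : TLInf δ →ₐ[ℂ] ConjOp δ :=
  RingQuot.liftAlgHom ℂ ⟨FreeAlgebra.lift ℂ (fun i => toConjOp δ (e δ i)), by
    intro x y h
    induction h with
    | sq i =>
      rw [map_mul, map_smul, FreeAlgebra.lift_ι_apply, toConjOp_mul, smul_toConjOp,
        Complex.conj_ofReal, e_sq]
    | up i =>
      simp only [map_mul, FreeAlgebra.lift_ι_apply, toConjOp_mul]
      rw [← mul_assoc, e_up]
    | down i =>
      simp only [map_mul, FreeAlgebra.lift_ι_apply, toConjOp_mul]
      rw [← mul_assoc, e_down]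
    | comm i j hij =>
      simp only [map_mul, FreeAlgebra.lift_ι_apply, toConjOp_mul]
      rw [e_comm δ i j hij]⟩

/-- The involution `*`: the conjugate-linear antiautomorphism fixing every generator. -/
def reflect (δ : ℝ) (x : TLInf δ) : TLInf δ := ofConjOp δ (reflectHom δ x)

theorem reflectHom_e (δ : ℝ) (i : ℕ) : reflectHom δ (e δ i) = toConjOp δ (e δ i) := by
  unfold reflectHom
  conv_lhs => arg 2; unfold e
  rw [RingQuot.liftAlgHom_mkAlgHom_apply, FreeAlgebra.lift_ι_apply]

theorem reflect_e (δ : ℝ) (i : ℕ) : reflect δ (e δ i) = e δ i := by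
  unfold reflect
  rw [reflectHom_e]
  rfl

theorem reflect_add (δ : ℝ) (x y : TLInf δ) : reflect δ (x + y) = reflect δ x + reflect δ y := by
  unfold reflect
  rw [map_add]
  rfl

theorem reflect_mul (δ : ℝ) (x y : TLInf δ) : reflect δ (x * y) = reflect δ y * reflect δ x := by
  unfold reflect
  rw [map_mul]
  rfl

theorem reflect_algebraMap (δ : ℝ) (c : ℂ) :
    reflect δ (algebraMap ℂ (TLInf δ) c) = algebraMap ℂ (TLInf δ) (starRingEnd ℂ c) := by
  unfold reflect
  rw [AlgHom.commutes]
  rfl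

theorem reflect_reflect (δ : ℝ) (x : TLInf δ) : reflect δ (reflect δ x) = x := by
  obtain ⟨y, rfl⟩ := RingQuot.mkAlgHom_surjective ℂ (Rel δ) x
  induction y using FreeAlgebra.induction with
  | grade0 r => rw [AlgHom.commutes, reflect_algebraMap, reflect_algebraMap, Complex.conj_conj]
  | grade1 i => exact (congrArg _ (reflect_e δ i)).trans (reflect_e δ i)
  | mul a b ha hb => rw [map_mul, reflect_mul, reflect_mul, ha, hb]
  | add a b ha hb => rw [map_add, reflect_add, reflect_add, ha, hb]

instance (δ : ℝ) : StarRing (TLInf δ) where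
  star := reflect δ
  star_involutive := reflect_reflect δ
  star_mul := reflect_mul δ
  star_add := reflect_add δ

instance (δ : ℝ) : StarModule ℂ (TLInf δ) where
  star_smul c x := by
    change reflect δ (c • x) = star c • reflect δ x
    rw [Algebra.smul_def, reflect_mul, reflect_algebraMap, Algebra.smul_def, Algebra.commutes]
    rfl

theorem star_e (δ : ℝ) (i : ℕ) : star (e δ i) = e δ i := reflect_e δ i

/-! ### Link states and the standard representations -/

/-- The pairing obtained by putting the diagram `e_{i+1}` on top of the pairing `m`: the points
`i` and `i + 1` are paired, and their former partners are paired with each other (if one of the two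
was a defect, then the partner of the other becomes a defect). -/
def join (i : ℕ) (m : ℕ → ℕ) (j : ℕ) : ℕ :=
  if j = i then i + 1
  else if j = i + 1 then i
  else if m j = i then (if m (i + 1) = i + 1 then j else m (i + 1))
  else if m j = i + 1 then (if m i = i then j else m i)
  else m j

/-- A non-crossing pairing of points `0, 1, 2, …`: an involution whose two-cycles are the cups and
whose fixed points are the defects (through strands). No two cups cross and no defect lies under
a cup. -/
structure IsPlanar (m : ℕ → ℕ) : Prop where
  invol : ∀ j, m (m j) = j
  planar : ∀ a b, a < b → b < m a → a < m b ∧ m b < m a ∧ m b ≠ b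

theorem join_planar (i : ℕ) (m : ℕ → ℕ) (h : IsPlanar m) (hi : ¬ (m i = i ∧ m (i+1) = i+1)) :
    IsPlanar (join i m) := by
  have hinv := h.invol
  constructor
  · intro j
    have h1 := hinv i
    have h2 := hinv (i+1)
    have h3 := hinv j
    unfold join
    grind (splits := 40)
  · intro a b hab hb
    have h1 := hinv i
    have h2 := hinv (i+1)
    have h3 := hinv a
    have h4 := hinv b
    have p := h.planar
    have hx := hinv (i)
    generalize hX : m i = x at *
    generalize hY : m (i+1) = y at *
    have q1 := p a b
    have q2 := p a i
    have q3 := p a (i+1)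
    have q4 := p i a
    have q5 := p i b
    have q6 := p (i+1) a
    have q7 := p (i+1) b
    have q8 := p x a
    have q9 := p x b
    have q10 := p y a
    have q11 := p y b
    have q12 := p b i
    have q13 := p b (i+1)
    have q14 := p (m b) i
    have q15 := p (m b) (i+1)
    have q16 := p x (i+1)
    have q17 := p i y
    have r1 := p i (m b)
    have r2 := p (i+1) (m b)
    have r3 := p x (m b)
    have r4 := p y (m b)
    clear p
    unfold join at *
    grind (splits := 60)

theorem join_self (i : ℕ) (m : ℕ → ℕ) (h : IsPlanar m) (hi : m i = i+1) : join i m = m := by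
  have hinv := h.invol i
  funext j
  unfold join
  grind (splits := 40)

theorem join_up (i : ℕ) (m : ℕ → ℕ) (h : IsPlanar m)  :
    join i (join (i+1) (join i m)) = join i m := by
  funext j
  have hinv := h.invol
  have h1 := hinv i
  have h2 := hinv (i+1)
  have h3 := hinv (i+2)
  have h4 := hinv j
  unfold join
  grind (splits := 40)
theorem join_down (i : ℕ) (m : ℕ → ℕ) (h : IsPlanar m)  :
    join (i+1) (join (i) (join (i+1) m)) = join (i+1) m := by
  funext j
  have hinv := h.invol
  have h1 := hinv i
  have h2 := hinv (i+1)
  have h3 := hinv (i+2)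
  have h4 := hinv j
  unfold join
  grind (splits := 40)
theorem join_comm (i k : ℕ) (hk : i + 1 < k) (m : ℕ → ℕ) (h : IsPlanar m)  :
    join i (join k m) = join k (join i m) := by
  funext j
  have hinv := h.invol
  have h1 := hinv i
  have h2 := hinv (i+1)
  have h3 := hinv k
  have h5 := hinv (k+1)
  have h4 := hinv j
  unfold join
  grind (splits := 40)

theorem join_fixed_iff (i : ℕ) (m : ℕ → ℕ) (h : IsPlanar m)
    (h1 : m i ≠ i) (h2 : m (i + 1) ≠ i + 1) (j : ℕ) : join i m j = j ↔ m j = j := by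
  have hinv := h.invol
  have h3 := hinv i
  have h4 := hinv (i+1)
  have h5 := hinv j
  unfold join
  grind (splits := 40)

/-- An `(n, p)`-link state: a non-crossing pairing of `n` points with `p` cups and `n - 2p` defects
(the points `j ≥ n` are not part of the picture; they are kept fixed). -/
structure IsLinkState (n p : ℕ) (m : ℕ → ℕ) : Prop where
  isPlanar : IsPlanar m
  fixed : ∀ j, n ≤ j → m j = j
  card : (Finset.filter (fun j => m j ≠ j) (Finset.range n)).card = 2 * p

theorem IsLinkState.join {n p i : ℕ} {m : ℕ → ℕ} (h : IsLinkState n p m) (hin : i + 1 < n)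
    (hi : ¬ (m i = i ∧ m (i + 1) = i + 1)) : IsLinkState n p (join i m) := by
  have hinv := h.isPlanar.invol
  have hfix := h.fixed
  refine ⟨join_planar i m h.isPlanar hi, ?_, ?_⟩
  · intro j hj
    have h1 := hinv i
    have h2 := hinv (i + 1)
    have h3 := hfix j hj
    unfold TemperleyLieb.join
    grind
  · rw [← h.card]
    by_cases h1 : m i = i
    · have h2 : m (i + 1) ≠ i + 1 := fun h2 => hi ⟨h1, h2⟩
      have hlt : m (i + 1) < n := by
        by_contra hge
        have h3 := hfix _ (not_lt.mp hge)
        rw [hinv] at h3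
        exact h2 h3.symm
      refine Finset.card_bij' (fun j _ => if j = i then m (i + 1) else j)
        (fun j _ => if j = m (i + 1) then i else j) ?_ ?_ ?_ ?_ <;>
      · intro j hj
        have h3 := hinv j
        have h4 := hinv (i + 1)
        simp only [Finset.mem_filter, Finset.mem_range, TemperleyLieb.join] at *
        grind
    · by_cases h2 : m (i + 1) = i + 1
      · have hlt : m i < n := by
          by_contra hge
          have h3 := hfix _ (not_lt.mp hge)
          rw [hinv] at h3
          exact h1 h3.symm
        refine Finset.card_bij' (fun j _ => if j = i + 1 then m i else j)
          (fun j _ => if j = m i then i + 1 else j) ?_ ?_ ?_ ?_ <;>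
        · intro j hj
          have h3 := hinv j
          have h4 := hinv i
          simp only [Finset.mem_filter, Finset.mem_range, TemperleyLieb.join] at *
          grind
      · congr 1
        ext j
        simp only [Finset.mem_filter, ne_eq, join_fixed_iff i m h.isPlanar h1 h2]

/-- The non-crossing pairings of `0, 1, 2, …`. -/
abbrev Pairing : Type := {m : ℕ → ℕ // IsPlanar m}

/-- The action of `e_{i+1}` on a pairing, by concatenation: a closed loop gives a factor `δ`, and the
result is zero if two defects get connected. -/
noncomputable def actOn (δ : ℝ) (i : ℕ) (m : Pairing) : Pairing →₀ ℂ :=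
  if h : m.1 i = i ∧ m.1 (i + 1) = i + 1 then 0
  else Finsupp.single ⟨join i m.1, join_planar i m.1 m.2 h⟩ (if m.1 i = i + 1 then (δ : ℂ) else 1)

/-- The linear extension of `actOn`. -/
noncomputable def actE (δ : ℝ) (i : ℕ) : (Pairing →₀ ℂ) →ₗ[ℂ] (Pairing →₀ ℂ) :=
  Finsupp.linearCombination ℂ (actOn δ i)

theorem actE_single (δ : ℝ) (i : ℕ) (m : Pairing) (c : ℂ) :
    actE δ i (Finsupp.single m c) = c • actOn δ i m := by
  simp [actE, Finsupp.linearCombination_single]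

theorem actOn_zero (δ : ℝ) (i : ℕ) (m : Pairing) (h : m.1 i = i ∧ m.1 (i + 1) = i + 1) :
    actOn δ i m = 0 := by
  unfold actOn; rw [dif_pos h]

theorem actOn_loop (δ : ℝ) (i : ℕ) (m : Pairing) (h : m.1 i = i + 1) :
    actOn δ i m = Finsupp.single m (δ : ℂ) := by
  unfold actOn
  rw [dif_neg (by rintro ⟨h1, -⟩; omega), if_pos h]
  congr 1
  exact Subtype.ext (join_self i m.1 m.2 h)

theorem actOn_join (δ : ℝ) (i : ℕ) (m : Pairing) (h : ¬ (m.1 i = i ∧ m.1 (i + 1) = i + 1))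
    (h' : m.1 i ≠ i + 1) :
    actOn δ i m = Finsupp.single ⟨join i m.1, join_planar i m.1 m.2 h⟩ 1 := by
  unfold actOn
  rw [dif_neg h, if_neg h']

theorem actE_sq (δ : ℝ) (i : ℕ) : actE δ i * actE δ i = (δ : ℂ) • actE δ i := by
  ext1 m
  ext1
  simp only [Module.End.mul_apply, LinearMap.comp_apply, Finsupp.lsingle_apply,
    LinearMap.smul_apply, actE_single, one_smul]
  unfold actOn
  split_ifs with h1 h2
  · simp
  · rw [actE_single, actOn_loop _ _ _ (by simp [join])]
  · rw [actE_single, actOn_loop _ _ _ (by simp [join]), one_smul, Finsupp.smul_single, smul_eq_mul,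
      mul_one]

theorem actE_up (δ : ℝ) (i : ℕ) : actE δ i * actE δ (i + 1) * actE δ i = actE δ i := by
  ext1 m
  ext1
  simp only [Module.End.mul_apply, LinearMap.comp_apply, Finsupp.lsingle_apply, actE_single,
    one_smul]
  by_cases h1 : m.1 i = i ∧ m.1 (i + 1) = i + 1
  · rw [actOn_zero _ _ _ h1]; simp
  · have h2 : actOn δ i m = Finsupp.single ⟨join i m.1, join_planar i m.1 m.2 h1⟩
        (if m.1 i = i + 1 then (δ : ℂ) else 1) := by unfold actOn; rw [dif_neg h1]
    have e1 : join i m.1 i = i + 1 := by simp [join]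
    have e2 : join i m.1 (i + 1) = i := by simp [join]
    rw [h2, actE_single, actOn_join]
    rotate_left
    · rintro ⟨h3, -⟩; simp only [e2] at h3; omega
    · simp only [e2]; omega
    have e3 : join (i + 1) (join i m.1) (i + 1) = i + 1 + 1 := by simp [join]
    rw [map_smul, actE_single, one_smul, actOn_join]
    rotate_left
    · rintro ⟨-, h3⟩; simp only [e3] at h3; omega
    · intro h3
      have h4 := (join_planar (i + 1) (join i m.1) (join_planar i m.1 m.2 h1)
        (by rw [e2]; omega)).invol i
      simp only at h3
      rw [h3, e3] at h4
      omega
    rw [Finsupp.smul_single, smul_eq_mul, mul_one]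
    congr 1
    exact Subtype.ext (join_up i m.1 m.2)

theorem actE_down (δ : ℝ) (i : ℕ) :
    actE δ (i + 1) * actE δ i * actE δ (i + 1) = actE δ (i + 1) := by
  ext1 m
  ext1
  simp only [Module.End.mul_apply, LinearMap.comp_apply, Finsupp.lsingle_apply, actE_single,
    one_smul]
  by_cases h1 : m.1 (i + 1) = i + 1 ∧ m.1 (i + 1 + 1) = i + 1 + 1
  · rw [actOn_zero _ _ _ h1]; simp
  · have h2 : actOn δ (i + 1) m = Finsupp.single ⟨join (i + 1) m.1, join_planar (i + 1) m.1 m.2 h1⟩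
        (if m.1 (i + 1) = i + 1 + 1 then (δ : ℂ) else 1) := by unfold actOn; rw [dif_neg h1]
    have e1 : join (i + 1) m.1 (i + 1) = i + 1 + 1 := by simp [join]
    have h5 := (join_planar (i + 1) m.1 m.2 h1).invol i
    rw [h2, actE_single, actOn_join]
    rotate_left
    · rintro ⟨-, h3⟩; simp only [e1] at h3; omega
    · intro h3
      simp only at h3
      rw [h3, e1] at h5
      omega
    have e3 : join i (join (i + 1) m.1) (i + 1) = i := by simp [join]
    rw [map_smul, actE_single, one_smul, actOn_join]
    rotate_left
    · rintro ⟨h3, -⟩; simp only [e3] at h3; omega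
    · simp only [e3]; omega
    rw [Finsupp.smul_single, smul_eq_mul, mul_one]
    congr 1
    exact Subtype.ext (join_down i m.1 m.2)

theorem actE_comm (δ : ℝ) (i k : ℕ) (hk : i + 1 < k) :
    actE δ i * actE δ k = actE δ k * actE δ i := by
  ext1 m
  ext1
  simp only [Module.End.mul_apply, LinearMap.comp_apply, Finsupp.lsingle_apply, actE_single,
    one_smul]
  have hj := join_comm i k hk m.1 m.2
  have a1 := m.2.invol i
  have a2 := m.2.invol (i + 1)
  have a3 := m.2.invol k
  have a4 := m.2.invol (k + 1)
  have v1 : join i m.1 k = k ↔ (m.1 k = k ∨ (m.1 k = i ∧ m.1 (i + 1) = i + 1) ∨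
      (m.1 k = i + 1 ∧ m.1 i = i)) := by
    clear hj
    unfold join
    grind (splits := 40)
  have v2 : join i m.1 (k + 1) = k + 1 ↔ (m.1 (k + 1) = k + 1 ∨
      (m.1 (k + 1) = i ∧ m.1 (i + 1) = i + 1) ∨ (m.1 (k + 1) = i + 1 ∧ m.1 i = i)) := by
    clear hj
    unfold join
    grind (splits := 40)
  have v3 : join k m.1 i = i ↔ (m.1 i = i ∨ (m.1 i = k ∧ m.1 (k + 1) = k + 1) ∨
      (m.1 i = k + 1 ∧ m.1 k = k)) := by
    clear hj
    unfold join
    grind (splits := 40)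
  have v4 : join k m.1 (i + 1) = i + 1 ↔ (m.1 (i + 1) = i + 1 ∨
      (m.1 (i + 1) = k ∧ m.1 (k + 1) = k + 1) ∨ (m.1 (i + 1) = k + 1 ∧ m.1 k = k)) := by
    clear hj
    unfold join
    grind (splits := 40)
  have v5 : join i m.1 k = k + 1 ↔ (m.1 k = k + 1 ∨ (m.1 k = i ∧ m.1 (k + 1) = i + 1) ∨
      (m.1 k = i + 1 ∧ m.1 (k + 1) = i)) := by
    clear hj
    unfold join
    grind (splits := 40)
  have v6 : join k m.1 i = i + 1 ↔ (m.1 i = i + 1 ∨ (m.1 i = k ∧ m.1 (i + 1) = k + 1) ∨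
      (m.1 i = k + 1 ∧ m.1 (i + 1) = k)) := by
    clear hj
    unfold join
    grind (splits := 40)
  have w : ∀ (s t : ℕ) (z : Pairing), actE δ s (actOn δ t z) =
      if h : z.1 t = t ∧ z.1 (t + 1) = t + 1 then 0 else
      if h' : join t z.1 s = s ∧ join t z.1 (s + 1) = s + 1 then 0 else
      Finsupp.single ⟨join s (join t z.1), join_planar s _ (join_planar t _ z.2 h) h'⟩
        ((if z.1 t = t + 1 then (δ : ℂ) else 1) * (if join t z.1 s = s + 1 then (δ : ℂ) else 1)) := by
    intro s t z
    by_cases h : z.1 t = t ∧ z.1 (t + 1) = t + 1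
    · rw [actOn_zero _ _ _ h, dif_pos h, map_zero]
    · conv_lhs => arg 2; unfold actOn; rw [dif_neg h]
      rw [dif_neg h, actE_single]
      unfold actOn
      split_ifs <;> simp
  rw [w, w]
  by_cases hA : m.1 k = k ∧ m.1 (k + 1) = k + 1
  · rw [dif_pos hA]
    by_cases hB : m.1 i = i ∧ m.1 (i + 1) = i + 1
    · rw [dif_pos hB]
    · rw [dif_neg hB, dif_pos ⟨v1.2 (Or.inl hA.1), v2.2 (Or.inl hA.2)⟩]
  · rw [dif_neg hA]
    by_cases hB : m.1 i = i ∧ m.1 (i + 1) = i + 1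
    · rw [dif_pos hB, dif_pos ⟨v3.2 (Or.inl hB.1), v4.2 (Or.inl hB.2)⟩]
    · rw [dif_neg hB]
      by_cases hC : join k m.1 i = i ∧ join k m.1 (i + 1) = i + 1
      · have hD : join i m.1 k = k ∧ join i m.1 (k + 1) = k + 1 := by
          clear hj w v5 v6
          grind
        rw [dif_pos hC, dif_pos hD]
      · have hD : ¬ (join i m.1 k = k ∧ join i m.1 (k + 1) = k + 1) := by
          clear hj w v5 v6
          grind
        rw [dif_neg hC, dif_neg hD]
        have hcoef : ((if m.1 k = k + 1 then (δ : ℂ) else 1) *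
            (if join k m.1 i = i + 1 then (δ : ℂ) else 1)) =
            ((if m.1 i = i + 1 then (δ : ℂ) else 1) *
            (if join i m.1 k = k + 1 then (δ : ℂ) else 1)) := by
          clear hj w v1 v2 v3 v4 hC hD
          by_cases c1 : m.1 k = k + 1 <;> by_cases c2 : m.1 i = i + 1 <;>
            by_cases c3 : join k m.1 i = i + 1 <;> by_cases c4 : join i m.1 k = k + 1 <;>
            simp only [c1, c2, c3, c4, if_true, if_false, mul_one, one_mul] <;> grind
        rw [hcoef]
        congr 1
        exact Subtype.ext hj

/-- The representation of `TL_∞` on the span of all non-crossing pairings of `0, 1, 2, …`. -/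
noncomputable def pairingRep (δ : ℝ) : TLInf δ →ₐ[ℂ] Module.End ℂ (Pairing →₀ ℂ) :=
  RingQuot.liftAlgHom ℂ ⟨FreeAlgebra.lift ℂ (actE δ), by
    intro x y h
    induction h with
    | sq i =>
      rw [map_mul, map_smul, FreeAlgebra.lift_ι_apply, actE_sq]
    | up i =>
      simp only [map_mul, FreeAlgebra.lift_ι_apply]
      rw [actE_up]
    | down i =>
      simp only [map_mul, FreeAlgebra.lift_ι_apply]
      rw [actE_down]
    | comm i j hij =>
      simp only [map_mul, FreeAlgebra.lift_ι_apply]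
      rw [actE_comm δ i j hij]⟩

theorem pairingRep_e (δ : ℝ) (i : ℕ) : pairingRep δ (e δ i) = actE δ i := by
  unfold pairingRep e
  rw [RingQuot.liftAlgHom_mkAlgHom_apply, FreeAlgebra.lift_ι_apply]

/-- The standard module `V_{n,p}`: the span of the `(n, p)`-link states. -/
noncomputable def stdModule (n p : ℕ) : Submodule ℂ (Pairing →₀ ℂ) :=
  Finsupp.supported ℂ ℂ {m | IsLinkState n p m.1}

theorem single_mem_stdModule {n p : ℕ} {m : Pairing} (h : IsLinkState n p m.1) (c : ℂ) :
    Finsupp.single m c ∈ stdModule n p :=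
  Finsupp.single_mem_supported ℂ c h

theorem stdModule_induction {n p : ℕ} {M : Type*} [AddCommMonoid M] [Module ℂ M]
    (W : Submodule ℂ M) (f : (Pairing →₀ ℂ) →ₗ[ℂ] M)
    (hf : ∀ m : Pairing, IsLinkState n p m.1 → f (Finsupp.single m 1) ∈ W)
    (v : Pairing →₀ ℂ) (hv : v ∈ stdModule n p) : f v ∈ W := by
  unfold stdModule at hv
  rw [Finsupp.supported_eq_span_single] at hv
  have : Submodule.span ℂ ((fun i => Finsupp.single i (1 : ℂ)) '' {m : Pairing | IsLinkState n p m.1})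
      ≤ W.comap f := by
    rw [Submodule.span_le]
    rintro _ ⟨m, hm, rfl⟩
    exact hf m hm
  exact this hv

theorem actE_mem_stdModule (δ : ℝ) {n p i : ℕ} (hi : i + 1 < n) (v : Pairing →₀ ℂ)
    (hv : v ∈ stdModule n p) : actE δ i v ∈ stdModule n p := by
  refine stdModule_induction _ (actE δ i) ?_ v hv
  intro m hm
  rw [actE_single, one_smul]
  unfold actOn
  split_ifs with h h'
  · exact zero_mem _
  · exact single_mem_stdModule (hm.join hi h) _
  · exact single_mem_stdModule (hm.join hi h) _

theorem pairingRep_mem_stdModule (δ : ℝ) {n p : ℕ} (a : TLInf δ) (ha : a ∈ TLn δ n)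
    (v : Pairing →₀ ℂ) (hv : v ∈ stdModule n p) : pairingRep δ a v ∈ stdModule n p := by
  induction ha using Algebra.adjoin_induction generalizing v with
  | mem x hx =>
    obtain ⟨i, hi, rfl⟩ := hx
    rw [pairingRep_e]
    exact actE_mem_stdModule δ hi v hv
  | algebraMap r =>
    rw [AlgHom.commutes, Module.algebraMap_end_apply]
    exact Submodule.smul_mem _ _ hv
  | add x y _ _ hx hy =>
    rw [map_add, LinearMap.add_apply]
    exact add_mem (hx v hv) (hy v hv)
  | mul x y _ _ hx hy =>
    rw [map_mul, Module.End.mul_apply]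
    exact hx _ (hy v hv)

/-- The standard representation of `TL_n` on `V_{n,p}`. -/
noncomputable def stdRep (δ : ℝ) (n p : ℕ) : TLn δ n →ₐ[ℂ] Module.End ℂ (stdModule n p) :=
  AlgHom.ofLinearMap
    { toFun := fun a => (pairingRep δ a.1).restrict (pairingRep_mem_stdModule δ a.1 a.2)
      map_add' := fun a b => by
        ext1 v
        apply Subtype.ext
        simp [LinearMap.restrict_apply]
      map_smul' := fun c a => by
        ext1 v
        apply Subtype.ext
        simp [LinearMap.restrict_apply] }
    (by
      ext1 v
      apply Subtype.ext
      simp [LinearMap.restrict_apply])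
    (fun a b => by
      ext1 v
      apply Subtype.ext
      simp [LinearMap.restrict_apply])

/-- The matrix trace `t_{n,p}` of `V_{n,p}`. -/
noncomputable def stdTrace (δ : ℝ) (n p : ℕ) : TLn δ n →ₗ[ℂ] ℂ :=
  LinearMap.trace ℂ (stdModule n p) ∘ₗ (stdRep δ n p).toLinearMap

/-! ### The extremal trace with parameter `γ` -/

/-- `c_{n,0}`: determined by `c_{0,0} = c_{1,0} = 1` and `c_{n,0} = c_{n-1,0} - γ c_{n-2,0}`. -/
noncomputable def c0 (γ : ℂ) : ℕ → ℂ
  | 0 => 1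
  | 1 => 1
  | n + 2 => c0 γ (n + 1) - γ * c0 γ n

/-- The trace coefficients `c_{n,i} = γ^i c_{n-2i,0}`, used for `2i ≤ n`. -/
noncomputable def coeff (γ : ℂ) (n i : ℕ) : ℂ := γ ^ i * c0 γ (n - 2 * i)

/-- The trace `∑_i c_{n,i} t_{n,i}` on `TL_n`. -/
noncomputable def levelTrace (δ : ℝ) (γ : ℂ) (n : ℕ) : TLn δ n →ₗ[ℂ] ℂ :=
  ∑ i ∈ Finset.range (n / 2 + 1), coeff γ n i • stdTrace δ n i

/-! The level traces are compatible with the inclusions `TL_n ⊆ TL_{n+1}`. -/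

theorem finite_linkStates (n p : ℕ) : {m : Pairing | IsLinkState n p m.1}.Finite := by
  have hlt : ∀ m : Pairing, IsLinkState n p m.1 → ∀ j, j < n → m.1 j < n := by
    intro m hm j hj
    by_contra hge
    have h := hm.fixed _ (not_lt.mp hge)
    rw [m.2.invol] at h
    omega
  refine Set.Finite.of_injOn (t := (Set.univ : Set (Fin n → Fin (n + 1))))
    (f := fun m j => Fin.ofNat (n + 1) (m.1 j)) (fun _ _ => Set.mem_univ _) ?_ Set.finite_univ
  intro m hm m' hm' h
  apply Subtype.ext
  funext j
  by_cases hj : j < n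
  · have h1 := congrArg Fin.val (congrFun h ⟨j, hj⟩)
    simp only [Fin.ofNat] at h1
    rwa [Nat.mod_eq_of_lt (by have := hlt m hm j hj; omega),
      Nat.mod_eq_of_lt (by have := hlt m' hm' j hj; omega)] at h1
  · rw [hm.fixed j (not_lt.mp hj), hm'.fixed j (not_lt.mp hj)]

/-- The finite set of `(n, p)`-link states. -/
noncomputable def linkStates (n p : ℕ) : Finset Pairing := (finite_linkStates n p).toFinset

theorem mem_linkStates {n p : ℕ} {m : Pairing} : m ∈ linkStates n p ↔ IsLinkState n p m.1 := by
  simp [linkStates]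

theorem stdTrace_eq (δ : ℝ) (n p : ℕ) (a : TLn δ n) :
    stdTrace δ n p a = ∑ m ∈ linkStates n p, pairingRep δ a.1 (Finsupp.single m 1) m := by
  classical
  have : Fintype {m : Pairing | IsLinkState n p m.1} := (finite_linkStates n p).fintype
  let b : Module.Basis {m : Pairing | IsLinkState n p m.1} ℂ (stdModule n p) :=
    ⟨Finsupp.supportedEquivFinsupp {m : Pairing | IsLinkState n p m.1}⟩
  have hb : ∀ m, (b m : Pairing →₀ ℂ) = Finsupp.single m.1 1 := by
    intro m
    exact Finsupp.supportedEquivFinsupp_symm_single _ m 1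
  unfold stdTrace
  rw [LinearMap.comp_apply, LinearMap.trace_eq_matrix_trace ℂ b, Matrix.trace]
  have hs : linkStates n p = {m : Pairing | IsLinkState n p m.1}.toFinset := by
    ext m; simp [mem_linkStates]
  rw [hs, ← Finset.sum_set_coe {m : Pairing | IsLinkState n p m.1}
    (f := fun m => pairingRep δ a.1 (Finsupp.single m 1) m)]
  refine Finset.sum_congr rfl fun m _ => ?_
  rw [Matrix.diag_apply, LinearMap.toMatrix_apply]
  change pairingRep δ a.1 (b m : Pairing →₀ ℂ) m = _
  rw [hb]

/-- Removing the cup that ends at the point `n`. -/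
def cut (n : ℕ) (m : ℕ → ℕ) (j : ℕ) : ℕ := if j = n ∨ j = m n then j else m j

theorem cut_isLinkState {n p : ℕ} {m : ℕ → ℕ} (h : IsLinkState (n + 1) (p + 1) m) (hn : m n ≠ n) :
    IsLinkState n p (cut n m) := by
  have hinv := h.isPlanar.invol
  have hpl := h.isPlanar.planar
  have hfix := h.fixed
  have hlt : m n < n := by
    by_contra hge
    have h3 := hfix (m n) (by omega)
    rw [hinv] at h3
    omega
  refine ⟨⟨?_, ?_⟩, ?_, ?_⟩
  · intro j
    have := hinv j
    have := hinv n
    unfold cut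
    grind
  · intro a b hab hb
    have q1 := hpl a b
    have q2 := hpl (m n) a
    have q3 := hpl (m n) b
    have q4 := hpl a (m n)
    have q5 := hpl a n
    have := hinv n
    have := hinv a
    have := hinv b
    have := hfix a
    have := hfix (m a)
    unfold cut at *
    grind
  · intro j hj
    have := hfix j
    unfold cut
    grind
  · have hc := h.card
    have : Finset.filter (fun j => m j ≠ j) (Finset.range (n + 1)) =
        insert n (insert (m n) (Finset.filter (fun j => cut n m j ≠ j) (Finset.range n))) := by
      ext j
      have := hinv n
      simp only [Finset.mem_filter, Finset.mem_range, Finset.mem_insert, cut]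
      grind
    rw [this, Finset.card_insert_of_notMem, Finset.card_insert_of_notMem] at hc
    · omega
    · simp [cut]
    · simp only [Finset.mem_insert, cut]
      grind

theorem cut_injective {n p : ℕ} {m m' : ℕ → ℕ} (h : IsLinkState (n + 1) p m)
    (h' : IsLinkState (n + 1) p m') (hn : m n ≠ n) (hn' : m' n ≠ n) (hc : cut n m = cut n m') :
    m = m' := by
  have key : ∀ (m m' : ℕ → ℕ), IsLinkState (n + 1) p m → IsLinkState (n + 1) p m' → m n ≠ n →
      m' n ≠ n → cut n m = cut n m' → ¬ m n < m' n := by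
    intro m m' h h' hn hn' hc hlt
    have h1 := congrFun hc (m' n)
    have h2 := h.isPlanar.planar (m n) (m' n) hlt
    have h3 := h.isPlanar.invol n
    have h4 := h'.isPlanar.invol n
    have h5 := h'.fixed (m' n)
    unfold cut at h1
    grind
  have he : m n = m' n := le_antisymm (not_lt.mp (key m' m h' h hn' hn hc.symm))
    (not_lt.mp (key m m' h h' hn hn' hc))
  funext j
  have h1 := congrFun hc j
  have h3 := h.isPlanar.invol n
  have h4 := h'.isPlanar.invol n
  unfold cut at h1
  grind

/-- Adding a cup between the defect `k` and the point `n`. -/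
def glue (n k : ℕ) (m : ℕ → ℕ) (j : ℕ) : ℕ := if j = n then k else if j = k then n else m j

theorem exists_glue {n p : ℕ} {m : ℕ → ℕ} (h : IsLinkState n p m) (hp : 2 * p < n) :
    ∃ m' : ℕ → ℕ, IsLinkState (n + 1) (p + 1) m' ∧ m' n ≠ n ∧ cut n m' = m := by
  have hinv := h.isPlanar.invol
  have hpl := h.isPlanar.planar
  have hfix := h.fixed
  have hne : (Finset.filter (fun j => m j = j) (Finset.range n)).Nonempty := by
    rw [← Finset.card_pos]
    have h1 := Finset.card_filter_add_card_filter_not (s := Finset.range n) (fun j => m j = j)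
    have h2 := h.card
    rw [Finset.card_range] at h1
    simp only [ne_eq] at h2
    omega
  obtain ⟨k, hk⟩ : ∃ k, k = (Finset.filter (fun j => m j = j) (Finset.range n)).max' hne := ⟨_, rfl⟩
  have hk1 := Finset.max'_mem _ hne
  rw [← hk, Finset.mem_filter, Finset.mem_range] at hk1
  have hk2 : ∀ j, k < j → j < n → m j ≠ j := by
    intro j hj hjn hmj
    have h1 := Finset.le_max' (Finset.filter (fun j => m j = j) (Finset.range n)) j
      (Finset.mem_filter.mpr ⟨Finset.mem_range.mpr hjn, hmj⟩)
    rw [← hk] at h1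
    omega
  obtain ⟨hkn, hmk⟩ := hk1
  have hmn := hfix n le_rfl
  clear hk hne
  refine ⟨glue n k m, ⟨⟨?_, ?_⟩, ?_, ?_⟩, ?_, ?_⟩
  · intro j
    have := hinv j
    unfold glue
    grind
  · intro a b hab hb
    have q1 := hpl a b
    have q2 := hpl a k
    have q3 := hpl (m b) k
    have q4 := hpl (m b) a
    have q5 := hk2 a
    have q6 := hk2 b
    have := hinv a
    have := hinv b
    have := hfix b
    have := hfix a
    have := hfix (m b)
    have := hfix (m a)
    clear h hinv hpl hfix hk2
    unfold glue at *
    grind (splits := 40)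
  · intro j hj
    have := hfix j
    unfold glue
    grind
  · have hc := h.card
    have : Finset.filter (fun j => glue n k m j ≠ j) (Finset.range (n + 1)) =
        insert n (insert k (Finset.filter (fun j => m j ≠ j) (Finset.range n))) := by
      ext j
      simp only [Finset.mem_filter, Finset.mem_range, Finset.mem_insert, glue]
      grind
    rw [this, Finset.card_insert_of_notMem, Finset.card_insert_of_notMem]
    · omega
    · simp [hmk]
    · simp only [Finset.mem_insert, Finset.mem_filter, Finset.mem_range]
      grind
  · simp [glue]; omega
  · funext j
    unfold cut glue
    grind

/-- Removal of the cup that ends at the point `n`, as a linear map; a link state in which `n` is a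
defect is sent to zero. -/
noncomputable def cutMap (n p : ℕ) : (Pairing →₀ ℂ) →ₗ[ℂ] (Pairing →₀ ℂ) :=
  Finsupp.linearCombination ℂ (fun m : Pairing =>
    open Classical in
    if h : IsLinkState (n + 1) (p + 1) m.1 ∧ m.1 n ≠ n then
      Finsupp.single (⟨cut n m.1, (cut_isLinkState h.1 h.2).isPlanar⟩ : Pairing) (1 : ℂ)
    else 0)

theorem cutMap_single_of_ne {n p : ℕ} {m : Pairing} (h : IsLinkState (n + 1) (p + 1) m.1)
    (hn : m.1 n ≠ n) (c : ℂ) : cutMap n p (Finsupp.single m c) =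
      Finsupp.single (⟨cut n m.1, (cut_isLinkState h hn).isPlanar⟩ : Pairing) c := by
  unfold cutMap
  rw [Finsupp.linearCombination_single, dif_pos ⟨h, hn⟩, Finsupp.smul_single, smul_eq_mul, mul_one]

theorem cutMap_single_of_eq {n p : ℕ} {m : Pairing} (hn : m.1 n = n) (c : ℂ) :
    cutMap n p (Finsupp.single m c) = 0 := by
  unfold cutMap
  rw [Finsupp.linearCombination_single, dif_neg (fun h => h.2 hn), smul_zero]

theorem cutMap_actE (δ : ℝ) {n p i : ℕ} (hi : i + 1 < n) (v : Pairing →₀ ℂ)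
    (hv : v ∈ stdModule (n + 1) (p + 1)) :
    cutMap n p (actE δ i v) = actE δ i (cutMap n p v) := by
  have key := stdModule_induction (n := n + 1) (p := p + 1) (⊥ : Submodule ℂ (Pairing →₀ ℂ))
    (cutMap n p ∘ₗ actE δ i - actE δ i ∘ₗ cutMap n p) ?_ v hv
  · rw [Submodule.mem_bot, LinearMap.sub_apply, sub_eq_zero] at key
    exact key
  intro m hm
  rw [Submodule.mem_bot, LinearMap.sub_apply, sub_eq_zero, LinearMap.comp_apply,
    LinearMap.comp_apply, actE_single, one_smul]
  have hinv := m.2.invol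
  have hn1 := hinv n
  have hi1 := hinv i
  have hi2 := hinv (i + 1)
  by_cases hn : m.1 n = n
  · rw [cutMap_single_of_eq hn, map_zero]
    unfold actOn
    split_ifs with h1 h2
    · rw [map_zero]
    all_goals
      refine cutMap_single_of_eq ?_ _
      simp only [join]
      grind
  · rw [cutMap_single_of_ne hm hn, actE_single, one_smul]
    by_cases h0 : m.1 i = i ∧ m.1 (i + 1) = i + 1
    · rw [actOn_zero _ _ _ h0, map_zero, actOn_zero]
      simp only [cut]
      grind
    by_cases hl : m.1 i = i + 1
    · rw [actOn_loop _ _ _ hl, cutMap_single_of_ne hm hn, actOn_loop]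
      simp only [cut]
      grind
    rw [actOn_join _ _ _ h0 hl]
    have hm' := hm.join (by omega) h0
    by_cases hn' : join i m.1 n = n
    · rw [cutMap_single_of_eq hn', actOn_zero]
      simp only [cut, join] at *
      grind
    · rw [cutMap_single_of_ne hm' hn', actOn_join]
      · congr 1
        apply Subtype.ext
        funext j
        have := hinv j
        simp only [cut, join] at *
        grind (splits := 40)
      · simp only [cut, join] at *
        grind
      · simp only [cut, join] at *
        grind

theorem cutMap_pairingRep (δ : ℝ) {n p : ℕ} (a : TLInf δ) (ha : a ∈ TLn δ n) (v : Pairing →₀ ℂ)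
    (hv : v ∈ stdModule (n + 1) (p + 1)) :
    cutMap n p (pairingRep δ a v) = pairingRep δ a (cutMap n p v) := by
  induction ha using Algebra.adjoin_induction generalizing v with
  | mem x hx =>
    obtain ⟨i, hi, rfl⟩ := hx
    rw [pairingRep_e]
    exact cutMap_actE δ hi v hv
  | algebraMap r =>
    rw [AlgHom.commutes, Module.algebraMap_end_apply, map_smul, Module.algebraMap_end_apply]
  | add x y _ _ hx hy =>
    rw [map_add, LinearMap.add_apply, LinearMap.add_apply, map_add, hx v hv, hy v hv]
  | mul x y _ hy' hx hy =>
    rw [map_mul, Module.End.mul_apply, Module.End.mul_apply, ← hy v hv]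
    exact hx _ (pairingRep_mem_stdModule δ y (TLn_mono δ (Nat.le_succ n) hy') v hv)

/-- The diagonal matrix entry of `a` at the link state `m`. -/
noncomputable def diagEntry (δ : ℝ) (a : TLInf δ) (m : Pairing) : ℂ :=
  pairingRep δ a (Finsupp.single m 1) m

theorem cutMap_apply {n p : ℕ} {m : Pairing} (hm : IsLinkState (n + 1) (p + 1) m.1)
    (hn : m.1 n ≠ n) (v : Pairing →₀ ℂ) (hv : v ∈ stdModule (n + 1) (p + 1)) :
    cutMap n p v (⟨cut n m.1, (cut_isLinkState hm hn).isPlanar⟩ : Pairing) = v m := by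
  have key := stdModule_induction (n := n + 1) (p := p + 1) (⊥ : Submodule ℂ ℂ)
    (Finsupp.lapply (⟨cut n m.1, (cut_isLinkState hm hn).isPlanar⟩ : Pairing) ∘ₗ cutMap n p
      - Finsupp.lapply m) ?_ v hv
  · rw [Submodule.mem_bot, LinearMap.sub_apply, sub_eq_zero] at key
    exact key
  intro k hk
  rw [Submodule.mem_bot, LinearMap.sub_apply, sub_eq_zero, LinearMap.comp_apply,
    Finsupp.lapply_apply, Finsupp.lapply_apply]
  by_cases hkn : k.1 n = n
  · rw [cutMap_single_of_eq hkn, Finsupp.zero_apply, Finsupp.single_eq_of_ne]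
    rintro rfl
    exact hn hkn
  · rw [cutMap_single_of_ne hk hkn]
    by_cases hkm : k = m
    · subst hkm
      rw [Finsupp.single_eq_same, Finsupp.single_eq_same]
    · rw [Finsupp.single_eq_of_ne (Ne.symm hkm), Finsupp.single_eq_of_ne]
      intro h
      exact hkm (Subtype.ext (cut_injective hk hm hkn hn (congrArg Subtype.val h).symm))

theorem diagEntry_cut (δ : ℝ) {n p : ℕ} {m : Pairing} (hm : IsLinkState (n + 1) (p + 1) m.1)
    (hn : m.1 n ≠ n) (a : TLInf δ) (ha : a ∈ TLn δ n) :
    diagEntry δ a (⟨cut n m.1, (cut_isLinkState hm hn).isPlanar⟩ : Pairing) = diagEntry δ a m := by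
  unfold diagEntry
  have hs := single_mem_stdModule hm 1
  rw [← cutMap_single_of_ne hm hn, ← cutMap_pairingRep δ a ha _ hs]
  exact cutMap_apply hm hn _
    (pairingRep_mem_stdModule δ a (TLn_mono δ (Nat.le_succ n) ha) _ hs)

theorem isLinkState_succ_iff {n p : ℕ} {m : ℕ → ℕ} (hn : m n = n) :
    IsLinkState (n + 1) p m ↔ IsLinkState n p m := by
  have hc : Finset.filter (fun j => m j ≠ j) (Finset.range (n + 1)) =
      Finset.filter (fun j => m j ≠ j) (Finset.range n) := by
    ext j
    simp only [Finset.mem_filter, Finset.mem_range]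
    grind
  constructor
  · intro h
    refine ⟨h.isPlanar, fun j hj => ?_, by rw [← hc]; exact h.card⟩
    have := h.fixed j
    grind
  · intro h
    exact ⟨h.isPlanar, fun j hj => h.fixed j (by omega), by rw [hc]; exact h.card⟩

theorem sum_linkStates_zero (δ : ℝ) (n : ℕ) (a : TLInf δ) :
    ∑ m ∈ linkStates (n + 1) 0, diagEntry δ a m = ∑ m ∈ linkStates n 0, diagEntry δ a m := by
  congr 1
  ext m
  rw [mem_linkStates, mem_linkStates]
  constructor
  · intro h
    have hn : m.1 n = n := by
      by_contra hne
      have h1 := h.card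
      rw [mul_zero, Finset.card_eq_zero] at h1
      have h2 : n ∈ Finset.filter (fun j => m.1 j ≠ j) (Finset.range (n + 1)) :=
        Finset.mem_filter.mpr ⟨Finset.mem_range.mpr (by omega), hne⟩
      rw [h1] at h2
      exact absurd h2 (Finset.notMem_empty n)
    exact (isLinkState_succ_iff hn).mp h
  · intro h
    exact (isLinkState_succ_iff (h.fixed n le_rfl)).mpr h

theorem sum_linkStates_succ (δ : ℝ) (n p : ℕ) (a : TLInf δ) (ha : a ∈ TLn δ n) :
    ∑ m ∈ linkStates (n + 1) (p + 1), diagEntry δ a m = ∑ m ∈ linkStates n (p + 1), diagEntry δ a m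
      + if 2 * p < n then ∑ m ∈ linkStates n p, diagEntry δ a m else 0 := by
  rw [← Finset.sum_filter_add_sum_filter_not (linkStates (n + 1) (p + 1)) (fun m => m.1 n = n)]
  congr 1
  · congr 1
    ext m
    rw [Finset.mem_filter, mem_linkStates, mem_linkStates]
    constructor
    · rintro ⟨h, hn⟩
      exact (isLinkState_succ_iff hn).mp h
    · intro h
      exact ⟨(isLinkState_succ_iff (h.fixed n le_rfl)).mpr h, h.fixed n le_rfl⟩
  · split_ifs with hp
    · refine Finset.sum_bij (fun m hm => (⟨cut n m.1, (cut_isLinkState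
        (mem_linkStates.mp (Finset.mem_filter.mp hm).1) (Finset.mem_filter.mp hm).2).isPlanar⟩ :
          Pairing)) ?_ ?_ ?_ ?_
      · intro m hm
        exact mem_linkStates.mpr (cut_isLinkState
          (mem_linkStates.mp (Finset.mem_filter.mp hm).1) (Finset.mem_filter.mp hm).2)
      · intro m hm m' hm' h
        exact Subtype.ext (cut_injective (mem_linkStates.mp (Finset.mem_filter.mp hm).1)
          (mem_linkStates.mp (Finset.mem_filter.mp hm').1) (Finset.mem_filter.mp hm).2
          (Finset.mem_filter.mp hm').2 (congrArg Subtype.val h))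
      · intro m hm
        obtain ⟨m', h1, h2, h3⟩ := exists_glue (mem_linkStates.mp hm) hp
        exact ⟨⟨m', h1.isPlanar⟩, Finset.mem_filter.mpr ⟨mem_linkStates.mpr h1, h2⟩,
          Subtype.ext h3⟩
      · intro m hm
        exact (diagEntry_cut δ (mem_linkStates.mp (Finset.mem_filter.mp hm).1)
          (Finset.mem_filter.mp hm).2 a ha).symm
    · refine Finset.sum_eq_zero fun m hm => ?_
      exfalso
      have hc := (mem_linkStates.mp (Finset.mem_filter.mp hm).1).card
      have hle := Finset.card_filter_le (Finset.range (n + 1)) (fun j => m.1 j ≠ j)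
      rw [hc, Finset.card_range] at hle
      omega

theorem linkStates_eq_empty {n p : ℕ} (h : n < 2 * p) : linkStates n p = ∅ := by
  rw [Finset.eq_empty_iff_forall_notMem]
  intro m hm
  have hc := (mem_linkStates.mp hm).card
  have hle := Finset.card_filter_le (Finset.range n) (fun j => m.1 j ≠ j)
  rw [hc, Finset.card_range] at hle
  omega

theorem levelTrace_eq (δ : ℝ) (γ : ℂ) (n N : ℕ) (hN : n / 2 + 1 ≤ N) (a : TLn δ n) :
    levelTrace δ γ n a =
      ∑ p ∈ Finset.range N, coeff γ n p * ∑ m ∈ linkStates n p, diagEntry δ a.1 m := by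
  unfold levelTrace
  rw [LinearMap.sum_apply, ← Finset.sum_subset (Finset.range_mono hN)]
  · refine Finset.sum_congr rfl fun p _ => ?_
    rw [LinearMap.smul_apply, stdTrace_eq, smul_eq_mul]
    rfl
  · intro p _ hp
    rw [Finset.mem_range, not_lt] at hp
    rw [linkStates_eq_empty (by omega), Finset.sum_empty, mul_zero]

theorem coeff_succ (γ : ℂ) {n p : ℕ} (h : 2 * p < n) :
    coeff γ (n + 1) p + coeff γ (n + 1) (p + 1) = coeff γ n p := by
  unfold coeff
  obtain ⟨k, rfl⟩ : ∃ k, n = 2 * p + k + 1 := ⟨n - 2 * p - 1, by omega⟩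
  rw [show 2 * p + k + 1 + 1 - 2 * p = k + 2 by omega,
    show 2 * p + k + 1 + 1 - 2 * (p + 1) = k by omega,
    show 2 * p + k + 1 - 2 * p = k + 1 by omega, c0]
  ring

theorem coeff_top (γ : ℂ) (p : ℕ) : coeff γ (2 * p + 1) p = coeff γ (2 * p) p := by
  unfold coeff
  rw [show 2 * p + 1 - 2 * p = 1 by omega, show 2 * p - 2 * p = 0 by omega]
  rfl

theorem levelTrace_succ (δ : ℝ) (γ : ℂ) (n : ℕ) (a : TLInf δ) (ha : a ∈ TLn δ n)
    (ha' : a ∈ TLn δ (n + 1)) : levelTrace δ γ (n + 1) ⟨a, ha'⟩ = levelTrace δ γ n ⟨a, ha⟩ := by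
  rw [levelTrace_eq δ γ (n + 1) (n + 2) (by omega), levelTrace_eq δ γ n (n + 2) (by omega),
    Finset.sum_range_succ', sum_linkStates_zero]
  simp only [sum_linkStates_succ δ n _ a ha, mul_add]
  rw [Finset.sum_add_distrib, add_right_comm, ← Finset.sum_range_succ' (fun p =>
    coeff γ (n + 1) p * ∑ m ∈ linkStates n p, diagEntry δ a m) (n + 1), Finset.sum_range_succ,
    Finset.sum_range_succ _ (n + 1), linkStates_eq_empty (n := n) (p := n + 1) (by omega),
    Finset.sum_empty, mul_zero, mul_zero, add_zero, add_zero, ← Finset.sum_add_distrib]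
  refine Finset.sum_congr rfl fun p _ => ?_
  split_ifs with hp
  · rw [← coeff_succ γ hp, add_mul]
  · rw [mul_zero, add_zero]
    rcases Nat.lt_or_ge n (2 * p) with h | h
    · rw [linkStates_eq_empty h, Finset.sum_empty, mul_zero, mul_zero]
    · obtain rfl : n = 2 * p := by omega
      rw [coeff_top]

theorem levelTrace_le (δ : ℝ) (γ : ℂ) {n k : ℕ} (h : n ≤ k) (a : TLInf δ) (ha : a ∈ TLn δ n)
    (ha' : a ∈ TLn δ k) : levelTrace δ γ k ⟨a, ha'⟩ = levelTrace δ γ n ⟨a, ha⟩ := by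
  induction k, h using Nat.le_induction with
  | base => rfl
  | succ k hk ih => rw [levelTrace_succ δ γ k a (TLn_mono δ hk ha) ha', ih]

theorem levelTrace_congr (δ : ℝ) (γ : ℂ) {n k : ℕ} (a : TLInf δ) (ha : a ∈ TLn δ n)
    (ha' : a ∈ TLn δ k) : levelTrace δ γ k ⟨a, ha'⟩ = levelTrace δ γ n ⟨a, ha⟩ := by
  rcases le_total n k with h | h
  · exact levelTrace_le δ γ h a ha ha'
  · exact (levelTrace_le δ γ h a ha' ha).symm

/-- The trace on `TL_∞` with parameter `γ`: its restriction to every `TL_n` is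
`∑_i c_{n,i} t_{n,i}` (see `chi_eq`). -/
noncomputable def chi (δ : ℝ) (γ : ℂ) : TLInf δ →ₗ[ℂ] ℂ where
  toFun a := levelTrace δ γ (exists_mem_TLn δ a).choose ⟨a, (exists_mem_TLn δ a).choose_spec⟩
  map_add' a b := by
    have ha := (exists_mem_TLn δ a).choose_spec
    have hb := (exists_mem_TLn δ b).choose_spec
    have h1 := TLn_mono δ (le_max_left _ (exists_mem_TLn δ b).choose) ha
    have h2 := TLn_mono δ (le_max_right (exists_mem_TLn δ a).choose _) hb
    rw [← levelTrace_congr δ γ a ha h1, ← levelTrace_congr δ γ b hb h2, ← map_add]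
    exact levelTrace_congr δ γ (a + b) (add_mem h1 h2) _
  map_smul' c a := by
    have ha := (exists_mem_TLn δ a).choose_spec
    rw [RingHom.id_apply, ← map_smul]
    exact levelTrace_congr δ γ (c • a) (Subalgebra.smul_mem _ ha c) _

theorem chi_eq (δ : ℝ) (γ : ℂ) (n : ℕ) (a : TLn δ n) :
    chi δ γ (a : TLInf δ) = ∑ i ∈ Finset.range (n / 2 + 1), coeff γ n i * stdTrace δ n i a := by
  have h : chi δ γ (a : TLInf δ) = levelTrace δ γ n a := levelTrace_congr δ γ a.1 a.2 _
  rw [h]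
  unfold levelTrace
  simp

theorem chi_one (δ : ℝ) (γ : ℂ) : chi δ γ 1 = 1 := by
  have hid : IsLinkState 0 0 (fun j => j) :=
    ⟨⟨fun _ => rfl, fun a b h1 h2 => absurd h2 (by omega)⟩, fun _ _ => rfl, by simp⟩
  have hs : linkStates 0 0 = {⟨fun j => j, hid.isPlanar⟩} := by
    ext m
    rw [mem_linkStates, Finset.mem_singleton]
    constructor
    · intro h
      exact Subtype.ext (funext fun j => h.fixed j (Nat.zero_le j))
    · rintro rfl
      exact hid
  have h := chi_eq δ γ 0 1
  rw [OneMemClass.coe_one] at h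
  rw [h, Nat.zero_div, zero_add, Finset.sum_range_one, stdTrace_eq, hs, Finset.sum_singleton]
  simp [coeff, c0]

theorem chi_mul_comm (δ : ℝ) (γ : ℂ) (a b : TLInf δ) : chi δ γ (a * b) = chi δ γ (b * a) := by
  obtain ⟨n, hn⟩ := exists_mem_TLn δ a
  obtain ⟨k, hk⟩ := exists_mem_TLn δ b
  have h1 := TLn_mono δ (le_max_left n k) hn
  have h2 := TLn_mono δ (le_max_right n k) hk
  have h3 := chi_eq δ γ _ (⟨a, h1⟩ * ⟨b, h2⟩)
  have h4 := chi_eq δ γ _ (⟨b, h2⟩ * ⟨a, h1⟩)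
  refine Eq.trans h3 (Eq.trans ?_ h4.symm)
  refine Finset.sum_congr rfl fun i _ => ?_
  congr 1
  unfold stdTrace
  simp only [LinearMap.comp_apply, AlgHom.toLinearMap_apply, map_mul]
  exact LinearMap.trace_mul_comm ℂ _ _

/-! ### The inner product, indefiniteness and the Jones-Wenzl idempotents -/

/-- The form `⟨x, y⟩ = χ(x y^*)` on `TL_∞`. -/
noncomputable def form (δ : ℝ) (γ : ℂ) (x y : TLInf δ) : ℂ := chi δ γ (x * star y)

/-- A form is indefinite if its set of null vectors is non-empty and not closed under addition. -/
def IsIndefinite {V : Type*} [Add V] (B : V → V → ℂ) : Prop :=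
  {x : V | B x x = 0}.Nonempty ∧ ¬ ∀ x y : V, B x x = 0 → B y y = 0 → B (x + y) (x + y) = 0

/-- The quantum integers `[k]`, with `[2] = δ`. -/
def qInt (δ : ℝ) : ℕ → ℝ
  | 0 => 0
  | 1 => 1
  | k + 2 => δ * qInt δ (k + 1) - qInt δ k

/-- The Jones-Wenzl idempotent `f_n` placed on the strands `s + 1, …, s + n` (so `s` vertical strands
stand on its left), by the recursion `f_{n+1} = f_n - ([n] / [n+1]) f_n e_{s+n} f_n`. -/
noncomputable def jonesWenzl (δ : ℝ) (s : ℕ) : ℕ → TLInf δ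
  | 0 => 1
  | 1 => 1
  | n + 2 => jonesWenzl δ s (n + 1) - ((qInt δ (n + 1) / qInt δ (n + 2) : ℝ) : ℂ) •
      (jonesWenzl δ s (n + 1) * e δ (s + n) * jonesWenzl δ s (n + 1))

/-- The element `(f_{l-1} ⊗ 1 ⊗ 1) e_{l-1}` of `TL_{l+1}`. -/
noncomputable def witnessX (δ : ℝ) (l : ℕ) : TLInf δ := jonesWenzl δ 0 (l - 1) * e δ (l - 2)

/-- The element `(1 ⊗ 1 ⊗ f_{l-1}) e_2 e_3 ⋯ e_l` of `TL_{l+1}`. -/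
noncomputable def witnessY (δ : ℝ) (l : ℕ) : TLInf δ :=
  jonesWenzl δ 2 (l - 1) * ((List.range (l - 1)).map (fun k => e δ (k + 1))).prod

end TemperleyLieb

/-! Since `[l] = 0`, the partial trace of `f_{l-1}` over either outer strand vanishes, so the trace
property gives `‖x‖² = χ(x^* x) = 0`, and likewise for `y` (`form_witnessX_self`,
`form_witnessY_self`). The product `x y^*` is killed from the right by every generator of `TL_{l+1}`
except `e_1`, and `y x^*` by every one except `e_l`. An element `a` with `a e_j = 0` kills each link
state with a cup at `j`, because such a state lies in the image of `e_j`. The state without cups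
contributes nothing, so each cross term reduces to the state whose single cup sits at the border
(`chi_eq_of_annihilates_ne`): it is `c_{l+1,1}` times an entry `(-1)^l / [l-1]` of a Jones-Wenzl
idempotent. The case `δ = 0` is `l = 2`.

As `c_{l+1,1} = γ c_{l-1,0}`, the pair `x, y` proves indefiniteness unless `c_{l-1,0} = 0`. In that
case the Christoffel-Darboux identity at a square root `z` of `γ⁻¹` and its conjugate shows that `z`
is real; it may be taken positive, and `c_{k,0} = [k+1]_z / z^k`. A vector `v` of negative norm with
`χ(v^*) = χ(v)` produces null vectors `1 ± i t v` whose sum `2` is not null (`isIndefinite_of_neg`).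
If the form were not indefinite, the norms of `f_k` and `f_{k+1} e_{k+1}` would therefore force
`[k]_z > 0` and `[k]_δ > 0` for `0 < k < l`. Both families vanish at `k = l`, so the
Christoffel-Darboux identity at `δ` and `z` yields `δ = z`, that is `δ² γ = 1`, which is excluded
(`isIndefinite_of_c0_eq_zero`). -/

namespace TemperleyLieb

/-! ### Jones-Wenzl elements along an abstract Temperley-Lieb sequence -/

/-- The elements `u 0, …, u (K - 1)` satisfy the Temperley-Lieb relations. -/
structure IsTLSequence {A : Type*} [Ring A] [Algebra ℂ A] (δ : ℝ) (K : ℕ) (u : ℕ → A) : Prop where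
  sq : ∀ i, i < K → u i * u i = (δ : ℂ) • u i
  down : ∀ i, i + 1 < K → u (i + 1) * u i * u (i + 1) = u (i + 1)
  comm : ∀ i j, i + 1 < j → j < K → u i * u j = u j * u i

/-- The Jones-Wenzl recursion along a sequence of elements of an algebra. -/
noncomputable def jwSeq {A : Type*} [Ring A] [Algebra ℂ A] (δ : ℝ) (u : ℕ → A) : ℕ → A
  | 0 => 1
  | 1 => 1
  | n + 2 => jwSeq δ u (n + 1) - ((qInt δ (n + 1) / qInt δ (n + 2) : ℝ) : ℂ) •
      (jwSeq δ u (n + 1) * u n * jwSeq δ u (n + 1))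

section Sequence

variable {A : Type*} [Ring A] [Algebra ℂ A] {δ : ℝ} {u : ℕ → A}

/-- The element is `1` plus multiples of words in the `u j`, all of which kill `h`. With `h` a
Jones-Wenzl element this gives idempotency, absorption of shorter ones, and uniqueness. -/
theorem jwSeq_mul_of_annihilated (h : A) :
    ∀ n, (∀ j, j + 1 < n → u j * h = 0) → jwSeq δ u n * h = h
  | 0, _ => by simp [jwSeq]
  | 1, _ => by simp [jwSeq]
  | n + 2, H => by
    have ih := jwSeq_mul_of_annihilated h (n + 1) (fun j hj => H j (by omega))
    rw [jwSeq, sub_mul, smul_mul_assoc, mul_assoc, ih, mul_assoc, H n (by omega), mul_zero,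
      smul_zero, sub_zero]

theorem mul_jwSeq_of_annihilated (h : A) :
    ∀ n, (∀ j, j + 1 < n → h * u j = 0) → h * jwSeq δ u n = h
  | 0, _ => by simp [jwSeq]
  | 1, _ => by simp [jwSeq]
  | n + 2, H => by
    have ih := mul_jwSeq_of_annihilated h (n + 1) (fun j hj => H j (by omega))
    rw [jwSeq, mul_sub, mul_smul_comm, ← mul_assoc, ← mul_assoc, ih, H n (by omega), zero_mul,
      smul_zero, sub_zero]

theorem jwSeq_commute {K : ℕ} (hu : IsTLSequence δ K u) {j : ℕ} (hj : j < K) :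
    ∀ n, n ≤ j → Commute (jwSeq δ u n) (u j)
  | 0, _ => by rw [jwSeq]; exact Commute.one_left _
  | 1, _ => by rw [jwSeq]; exact Commute.one_left _
  | n + 2, h => by
    have ih := jwSeq_commute hu hj (n + 1) (by omega)
    have hc : Commute (u n) (u j) := hu.comm n j (by omega) hj
    rw [jwSeq]
    exact ih.sub_left (((ih.mul_left hc).mul_left ih).smul_left _)

/-- The Jones-Wenzl elements annihilate the generators, and their partial trace is a multiple of
the previous one. -/
theorem jwSeq_annihilates {K : ℕ} (hu : IsTLSequence δ K u) :
    ∀ n, n ≤ K → (∀ k, 0 < k → k ≤ n + 1 → qInt δ k ≠ 0) →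
      (∀ j, j < n → u j * jwSeq δ u (n + 1) = 0) ∧ (∀ j, j < n → jwSeq δ u (n + 1) * u j = 0) ∧
      (n < K → u n * jwSeq δ u (n + 1) * u n =
        ((qInt δ (n + 2) / qInt δ (n + 1) : ℝ) : ℂ) • (jwSeq δ u n * u n))
  | 0, _, _ => by
    refine ⟨fun j hj => absurd hj (by omega), fun j hj => absurd hj (by omega), fun h => ?_⟩
    simp only [jwSeq, mul_one, one_mul, hu.sq 0 h, qInt]
    simp
  | n + 1, hn, hq => by
    obtain ⟨h1, h2, h3⟩ := jwSeq_annihilates hu n (by omega) (fun k h h' => hq k h (by omega))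
    have h3 := h3 (by omega)
    have q1 := hq (n + 1) (by omega) (by omega)
    have q2 := hq (n + 2) (by omega) (by omega)
    have hidem : jwSeq δ u (n + 1) * jwSeq δ u (n + 1) = jwSeq δ u (n + 1) :=
      jwSeq_mul_of_annihilated _ _ (fun j hj => h1 j (by omega))
    have hl : jwSeq δ u n * jwSeq δ u (n + 1) = jwSeq δ u (n + 1) :=
      jwSeq_mul_of_annihilated _ _ (fun j hj => h1 j (by omega))
    have hr : jwSeq δ u (n + 1) * jwSeq δ u n = jwSeq δ u (n + 1) :=
      mul_jwSeq_of_annihilated _ _ (fun j hj => h2 j (by omega))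
    have hcn : jwSeq δ u n * u n = u n * jwSeq δ u n :=
      jwSeq_commute hu (by omega) n le_rfl
    -- The coefficient in the recursion is the inverse of the partial trace factor; this makes the
    -- correction cancel the product with `u n`.
    have hone : ((qInt δ (n + 1) / qInt δ (n + 2) : ℝ) : ℂ) *
        ((qInt δ (n + 2) / qInt δ (n + 1) : ℝ) : ℂ) = 1 := by
      rw [← Complex.ofReal_mul, div_mul_div_cancel₀ q2, div_self q1, Complex.ofReal_one]
    refine ⟨?_, ?_, ?_⟩
    · intro j hj
      rw [jwSeq, mul_sub, mul_smul_comm, ← mul_assoc, ← mul_assoc]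
      rcases Nat.lt_or_ge j n with h | h
      · rw [h1 j h, zero_mul, zero_mul, smul_zero, sub_zero]
      · obtain rfl : j = n := by omega
        rw [h3, smul_mul_assoc, smul_smul, hone, one_smul, hcn, mul_assoc, hl, sub_self]
    · intro j hj
      rw [jwSeq, sub_mul, smul_mul_assoc]
      rcases Nat.lt_or_ge j n with h | h
      · rw [mul_assoc, h2 j h, mul_zero, smul_zero, sub_zero]
      · obtain rfl : j = n := by omega
        rw [mul_assoc _ _ (u j), mul_assoc _ (u j), ← mul_assoc (u j), h3, mul_smul_comm, smul_smul,
          hone, one_smul, ← mul_assoc, hr, sub_self]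
    · intro hK
      have hc : jwSeq δ u (n + 1) * u (n + 1) = u (n + 1) * jwSeq δ u (n + 1) :=
        jwSeq_commute hu hK (n + 1) le_rfl
      have e1 : u (n + 1) * jwSeq δ u (n + 1) * u (n + 1) =
          (δ : ℂ) • (jwSeq δ u (n + 1) * u (n + 1)) := by
        rw [← hc, mul_assoc, hu.sq _ hK, mul_smul_comm]
      have e2 : u (n + 1) * (jwSeq δ u (n + 1) * u n * jwSeq δ u (n + 1)) * u (n + 1) =
          jwSeq δ u (n + 1) * u (n + 1) := by
        -- `u (n + 1)` commutes past both Jones-Wenzl factors, which leaves `u (n + 1) * u n * u (n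
        -- + 1)` in the middle.
        calc _ = (u (n + 1) * jwSeq δ u (n + 1)) * u n * (jwSeq δ u (n + 1) * u (n + 1)) := by
              simp only [mul_assoc]
          _ = jwSeq δ u (n + 1) * (u (n + 1) * u n * u (n + 1)) * jwSeq δ u (n + 1) := by
              rw [← hc]
              conv_lhs => arg 2; rw [hc]
              simp only [mul_assoc]
          _ = _ := by
              rw [hu.down n hK, mul_assoc, ← hc, ← mul_assoc, hidem]
      -- What remains is `δ - [n+1]/[n+2] = [n+3]/[n+2]`, the recursion of the quantum integers.
      rw [jwSeq, mul_sub, sub_mul, mul_smul_comm, smul_mul_assoc, e1, e2, ← sub_smul]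
      congr 1
      rw [← Complex.ofReal_sub]
      congr 1
      rw [show qInt δ (n + 1 + 2) = δ * qInt δ (n + 2) - qInt δ (n + 1) from rfl]
      field_simp

end Sequence

/-! ### Jones-Wenzl idempotents in `TL_∞` and their partial traces -/

theorem jonesWenzl_eq_jwSeq (δ : ℝ) (s : ℕ) :
    ∀ n, jonesWenzl δ s n = jwSeq δ (fun i => e δ (s + i)) n
  | 0 => rfl
  | 1 => rfl
  | n + 2 => by rw [jonesWenzl, jwSeq, jonesWenzl_eq_jwSeq δ s (n + 1)]

theorem isTLSequence_shift (δ : ℝ) (s K : ℕ) : IsTLSequence δ K (fun i => e δ (s + i)) where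
  sq i _ := e_sq δ (s + i)
  down i _ := e_down δ (s + i)
  comm i j h _ := e_comm δ (s + i) (s + j) (by omega)

/-- Reversal exchanges the two cubic relations. It lets the recursion, which grows only at one end,
control the partial trace over the leftmost strand. Natural subtraction truncates, hence the bound
`M + 1` on the length. -/
theorem isTLSequence_reverse (δ : ℝ) (M : ℕ) : IsTLSequence δ (M + 1) (fun i => e δ (M - i)) where
  sq i _ := e_sq δ (M - i)
  down i h := by
    have h1 : M - i = M - (i + 1) + 1 := by omega
    simp only [h1]
    exact e_up δ _
  comm i j h h' := (e_comm δ (M - j) (M - i) (by omega)).symm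

theorem e_mul_jonesWenzl {δ : ℝ} {n : ℕ} (hq : ∀ k, 0 < k → k ≤ n → qInt δ k ≠ 0) (s : ℕ) {j : ℕ}
    (h1 : s ≤ j) (h2 : j + 1 < s + n) : e δ j * jonesWenzl δ s n = 0 := by
  obtain ⟨n, rfl⟩ : ∃ k, n = k + 1 := ⟨n - 1, by omega⟩
  have h := (jwSeq_annihilates (isTLSequence_shift δ s n) n le_rfl hq).1 (j - s) (by omega)
  rwa [← jonesWenzl_eq_jwSeq, show s + (j - s) = j by omega] at h

theorem jonesWenzl_mul_e {δ : ℝ} {n : ℕ} (hq : ∀ k, 0 < k → k ≤ n → qInt δ k ≠ 0) (s : ℕ) {j : ℕ}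
    (h1 : s ≤ j) (h2 : j + 1 < s + n) : jonesWenzl δ s n * e δ j = 0 := by
  obtain ⟨n, rfl⟩ : ∃ k, n = k + 1 := ⟨n - 1, by omega⟩
  have h := (jwSeq_annihilates (isTLSequence_shift δ s n) n le_rfl hq).2.1 (j - s) (by omega)
  rwa [← jonesWenzl_eq_jwSeq, show s + (j - s) = j by omega] at h

theorem jonesWenzl_mul_self {δ : ℝ} {n : ℕ} (hq : ∀ k, 0 < k → k ≤ n → qInt δ k ≠ 0) (s : ℕ) :
    jonesWenzl δ s n * jonesWenzl δ s n = jonesWenzl δ s n := by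
  conv_lhs => arg 1; rw [jonesWenzl_eq_jwSeq]
  exact jwSeq_mul_of_annihilated _ _ (fun j hj => e_mul_jonesWenzl hq s (by omega) (by omega))

/-- The partial trace of `f_{n+1}` over its last strand vanishes if `[n+2] = 0`. -/
theorem e_mul_jonesWenzl_mul_e_right {δ : ℝ} {n : ℕ} (hq : ∀ k, 0 < k → k ≤ n + 1 → qInt δ k ≠ 0)
    (h0 : qInt δ (n + 2) = 0) (s : ℕ) : e δ (s + n) * jonesWenzl δ s (n + 1) * e δ (s + n) = 0 := by
  have h := (jwSeq_annihilates (isTLSequence_shift δ s (n + 1)) n (by omega) hq).2.2 (by omega)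
  rwa [h0, zero_div, Complex.ofReal_zero, zero_smul, ← jonesWenzl_eq_jwSeq] at h

/-- The partial trace of `f_{n+1}` over its first strand vanishes if `[n+2] = 0`. -/
theorem e_mul_jonesWenzl_mul_e_left {δ : ℝ} {n : ℕ} (hq : ∀ k, 0 < k → k ≤ n + 1 → qInt δ k ≠ 0)
    (h0 : qInt δ (n + 2) = 0) (s : ℕ) :
    e δ s * jonesWenzl δ (s + 1) (n + 1) * e δ s = 0 := by
  -- In reversed order the element of length `n + 1` uses `e δ (s + n), …, e δ (s + 1)`, and the
  -- next generator is `e δ s`.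
  obtain ⟨h1, -, h3⟩ := jwSeq_annihilates (isTLSequence_reverse δ (s + n)) n (by omega) hq
  have h3 := h3 (by omega)
  rw [h0, zero_div, Complex.ofReal_zero, zero_smul] at h3
  have e1 : jonesWenzl δ (s + 1) (n + 1) * jwSeq δ (fun i => e δ (s + n - i)) (n + 1) =
      jwSeq δ (fun i => e δ (s + n - i)) (n + 1) := by
    rw [jonesWenzl_eq_jwSeq]
    refine jwSeq_mul_of_annihilated _ _ fun j hj => ?_
    have h := h1 (n - 1 - j) (by omega)
    simp only [show s + n - (n - 1 - j) = s + 1 + j by omega] at h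
    exact h
  -- The product of the forward and the reversed element equals each of them, so they coincide.
  have e2 : jonesWenzl δ (s + 1) (n + 1) * jwSeq δ (fun i => e δ (s + n - i)) (n + 1) =
      jonesWenzl δ (s + 1) (n + 1) :=
    mul_jwSeq_of_annihilated _ _ fun j hj => jonesWenzl_mul_e hq (s + 1) (by omega) (by omega)
  rw [← e2, e1]
  simpa using h3

theorem star_jonesWenzl (δ : ℝ) (s : ℕ) : ∀ n, star (jonesWenzl δ s n) = jonesWenzl δ s n
  | 0 => star_one _
  | 1 => star_one _
  | n + 2 => by
    have ih := star_jonesWenzl δ s (n + 1)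
    rw [jonesWenzl, star_sub, star_smul, star_mul, star_mul, ih, star_e, ← mul_assoc,
      RCLike.star_def, Complex.conj_ofReal]

theorem jonesWenzl_mem (δ : ℝ) (s : ℕ) : ∀ n, jonesWenzl δ s n ∈ TLn δ (s + n)
  | 0 => one_mem _
  | 1 => one_mem _
  | n + 2 => by
    have ih := TLn_mono δ (show s + (n + 1) ≤ s + (n + 2) by omega) (jonesWenzl_mem δ s (n + 1))
    rw [jonesWenzl]
    exact sub_mem ih (Subalgebra.smul_mem _ (mul_mem (mul_mem ih (e_mem δ (by omega))) ih) _)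

/-- The product `e_2 e_3 ⋯ e_{k+1}`, in classical numbering. -/
noncomputable def ascending (δ : ℝ) (k : ℕ) : TLInf δ :=
  ((List.range k).map (fun i => e δ (i + 1))).prod

theorem ascending_zero (δ : ℝ) : ascending δ 0 = 1 := rfl

theorem ascending_succ (δ : ℝ) (k : ℕ) : ascending δ (k + 1) = ascending δ k * e δ (k + 1) := by
  simp [ascending, List.range_succ]

/-- Exposes the leading `e_2`, the only factor needed when a partial trace or the state without cups
makes the product vanish. -/
theorem exists_ascending_eq (δ : ℝ) : ∀ k, ∃ b, ascending δ (k + 1) = e δ 1 * b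
  | 0 => ⟨1, by rw [ascending_succ, ascending_zero, one_mul, mul_one]⟩
  | k + 1 => by
    obtain ⟨b, hb⟩ := exists_ascending_eq δ k
    exact ⟨b * e δ (k + 2), by rw [ascending_succ, hb, mul_assoc]⟩

theorem ascending_mem (δ : ℝ) : ∀ k, ascending δ k ∈ TLn δ (k + 2)
  | 0 => one_mem _
  | k + 1 => by
    rw [ascending_succ]
    exact mul_mem (TLn_mono δ (by omega) (ascending_mem δ k)) (e_mem δ (by omega))

theorem star_mem_TLn {δ : ℝ} {n : ℕ} {a : TLInf δ} (ha : a ∈ TLn δ n) : star a ∈ TLn δ n := by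
  induction ha using Algebra.adjoin_induction with
  | mem x hx =>
    obtain ⟨i, hi, rfl⟩ := hx
    rw [star_e]
    exact e_mem δ hi
  | algebraMap r =>
    rw [Algebra.algebraMap_eq_smul_one, star_smul, star_one]
    exact Subalgebra.smul_mem _ (one_mem _) _
  | add x y _ _ hx hy =>
    rw [star_add]
    exact add_mem hx hy
  | mul x y _ _ hx hy =>
    rw [star_mul]
    exact mul_mem hy hx

/-! ### Evaluation of the trace on elements that annihilate generators -/

/-- The pairing without cups. -/
def noCup : Pairing := ⟨fun j => j, fun _ => rfl, fun a b h1 h2 => absurd h2 (by omega)⟩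

/-- The pairing whose only cup joins the points `j` and `j + 1`. -/
def oneCup (j : ℕ) : Pairing :=
  ⟨fun i => if i = j then j + 1 else if i = j + 1 then j else i, by intro i; grind,
    by intro a b h1 h2; grind⟩

theorem oneCup_apply (j i : ℕ) :
    (oneCup j).1 i = if i = j then j + 1 else if i = j + 1 then j else i := rfl

theorem oneCup_ne {i j : ℕ} (h : i ≠ j) : oneCup i ≠ oneCup j := by
  intro he
  have h1 := congrFun (congrArg Subtype.val he) i
  rw [oneCup_apply, oneCup_apply] at h1
  grind

theorem isLinkState_oneCup {n j : ℕ} (h : j + 1 < n) : IsLinkState n 1 (oneCup j).1 := by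
  refine ⟨(oneCup j).2, fun i hi => by rw [oneCup_apply]; grind, ?_⟩
  have : Finset.filter (fun i => (oneCup j).1 i ≠ i) (Finset.range n) = {j, j + 1} := by
    ext i
    simp only [Finset.mem_insert, Finset.mem_singleton, oneCup_apply]
    grind
  rw [this, Finset.card_pair (by omega)]

theorem linkStates_zero_right (n : ℕ) : linkStates n 0 = {noCup} := by
  ext m
  rw [mem_linkStates, Finset.mem_singleton]
  constructor
  · intro h
    have hc := h.card
    rw [mul_zero, Finset.card_eq_zero, Finset.filter_eq_empty_iff] at hc
    refine Subtype.ext (funext fun j => ?_)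
    rcases Nat.lt_or_ge j n with hj | hj
    · exact not_not.mp (hc (Finset.mem_range.mpr hj))
    · exact h.fixed j hj
  · rintro rfl
    exact ⟨noCup.2, fun _ _ => rfl, by simp [noCup]⟩

/-- Under every cup there is an innermost one. -/
theorem exists_innermost_cup {m : ℕ → ℕ} (h : IsPlanar m) :
    ∀ d a, a < m a → m a ≤ a + d → ∃ j, a ≤ j ∧ j < m a ∧ m j = j + 1
  | 0, a, h1, h2 => absurd h1 (by omega)
  | d + 1, a, h1, h2 => by
    by_cases h3 : m a = a + 1
    · exact ⟨a, le_rfl, h1, h3⟩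
    · obtain ⟨h4, h5, h6⟩ := h.planar a (a + 1) (by omega) (by omega)
      have h7 : a + 1 < m (a + 1) := by omega
      obtain ⟨j, hj1, hj2, hj3⟩ := exists_innermost_cup h d (a + 1) h7 (by omega)
      exact ⟨j, by omega, by omega, hj3⟩

theorem IsLinkState.exists_cup {n p : ℕ} {m : ℕ → ℕ} (h : IsLinkState n (p + 1) m) :
    ∃ a, a < m a ∧ m a < n := by
  have hc : 0 < (Finset.filter (fun j => m j ≠ j) (Finset.range n)).card := by
    rw [h.card]; omega
  obtain ⟨b, hb⟩ := Finset.card_pos.mp hc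
  rw [Finset.mem_filter, Finset.mem_range] at hb
  have h1 := h.isPlanar.invol b
  rcases Nat.lt_or_ge b (m b) with h2 | h2
  · refine ⟨b, h2, ?_⟩
    by_contra h3
    have h4 := h.fixed (m b) (by omega)
    omega
  · exact ⟨m b, by omega, by omega⟩

/-- This is `e_j e_{j+1} e_j = e_j` on states. No loop is closed, so the state is in the image of
`e_j` even when `δ = 0`. -/
theorem actE_actE_of_cup (δ : ℝ) {j : ℕ} {m : Pairing} (h : m.1 j = j + 1) :
    actE δ j (actE δ (j + 1) (Finsupp.single m 1)) = Finsupp.single m 1 := by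
  have h1 := m.2.invol j
  rw [h] at h1
  have h2 := m.2.invol (j + 2)
  rw [actE_single, one_smul, actOn_join _ _ _ (by omega) (by omega), actE_single, one_smul,
    actOn_join]
  · congr 1
    refine Subtype.ext ?_
    have h3 := join_up j m.1 m.2
    rwa [join_self j m.1 m.2 h] at h3
  · simp only [join]
    grind
  · simp only [join]
    grind

/-- The state equals `e_j e_{j+1} m`, so `a` kills it entirely, and not only its diagonal entry. -/
theorem diagEntry_eq_zero_of_cup {δ : ℝ} {a : TLInf δ} {j : ℕ} (ha : a * e δ j = 0) {m : Pairing}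
    (h : m.1 j = j + 1) : diagEntry δ a m = 0 := by
  unfold diagEntry
  rw [← actE_actE_of_cup δ h, ← pairingRep_e, ← Module.End.mul_apply, ← map_mul, ha, map_zero,
    LinearMap.zero_apply, Finsupp.zero_apply]

theorem chi_eq_sum (δ : ℝ) (γ : ℂ) {n : ℕ} {a : TLInf δ} (ha : a ∈ TLn δ n) :
    chi δ γ a = ∑ p ∈ Finset.range (n / 2 + 1),
      coeff γ n p * ∑ m ∈ linkStates n p, diagEntry δ a m := by
  have h := chi_eq δ γ n ⟨a, ha⟩
  rw [h]
  refine Finset.sum_congr rfl fun p _ => ?_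
  rw [stdTrace_eq]
  rfl

/-- The trace of an element that annihilates all generators of `TL_n`. -/
theorem chi_eq_of_annihilates (δ : ℝ) (γ : ℂ) {n : ℕ} {a : TLInf δ} (ha : a ∈ TLn δ n)
    (h : ∀ j, j + 1 < n → a * e δ j = 0) : chi δ γ a = c0 γ n * diagEntry δ a noCup := by
  rw [chi_eq_sum δ γ ha, Finset.sum_range_succ', Finset.sum_eq_zero, zero_add,
    linkStates_zero_right, Finset.sum_singleton, coeff, pow_zero, one_mul, mul_zero, Nat.sub_zero]
  intro p _
  rw [Finset.sum_eq_zero, mul_zero]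
  intro m hm
  have hm := mem_linkStates.mp hm
  obtain ⟨a, h1, h2⟩ := hm.exists_cup
  obtain ⟨j, h3, h4, h5⟩ := exists_innermost_cup m.2 (m.1 a) a h1 (by omega)
  exact diagEntry_eq_zero_of_cup (h j (by omega)) h5

/-- The trace of an element that annihilates all generators of `TL_n` but one at the border. -/
theorem chi_eq_of_annihilates_ne (δ : ℝ) (γ : ℂ) {n k : ℕ} {a : TLInf δ} (ha : a ∈ TLn δ n)
    (hk : k + 1 < n) (hk' : k = 0 ∨ k + 2 = n)
    (h : ∀ j, j + 1 < n → j ≠ k → a * e δ j = 0) (h0 : diagEntry δ a noCup = 0) :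
    chi δ γ a = coeff γ n 1 * diagEntry δ a (oneCup k) := by
  have key : ∀ p, ∀ m ∈ linkStates n (p + 1), m ≠ oneCup k → diagEntry δ a m = 0 := by
    intro p m hm hne
    have hm := mem_linkStates.mp hm
    by_contra hd
    have hin : ∀ j, j + 1 < n → m.1 j = j + 1 → j = k := by
      intro j hj hmj
      by_contra hjk
      exact hd (diagEntry_eq_zero_of_cup (h j hj hjk) hmj)
    have hcup : ∀ a, a < m.1 a → m.1 a < n → a = k ∧ m.1 k = k + 1 := by
      intro a h1 h2
      obtain ⟨j, h3, h4, h5⟩ := exists_innermost_cup m.2 (m.1 a) a h1 (by omega)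
      obtain rfl := hin j (by omega) h5
      have h6 := m.2.invol a
      have h7 := m.2.invol j
      -- At either border there is no room for a cup that encloses `(k, k + 1)`, so every cup is
      -- this one.
      rcases hk' with h8 | h8
      · exact ⟨by omega, h5⟩
      · have h9 : m.1 a = j + 1 := by omega
        rw [h5] at h7
        rw [h9] at h6
        exact ⟨by omega, h5⟩
    obtain ⟨a, h1, h2⟩ := hm.exists_cup
    have hk3 := (hcup a h1 h2).2
    apply hne
    refine Subtype.ext (funext fun i => ?_)
    rw [oneCup_apply]
    have h3 := m.2.invol k
    rw [hk3] at h3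
    split_ifs with i1 i2
    · rw [i1, hk3]
    · rw [i2, h3]
    · by_contra hi
      have h4 := m.2.invol i
      have h5 : ∀ b, n ≤ b → m.1 b = b := hm.fixed
      have h6 := h5 i
      have h7 := h5 (m.1 i)
      rcases Nat.lt_or_ge i (m.1 i) with h8 | h8
      · exact i1 (hcup i h8 (by omega)).1
      · have h9 := (hcup (m.1 i) (by omega) (by omega)).1
        rw [h9, hk3] at h4
        omega
  rw [chi_eq_sum δ γ ha, Finset.sum_range_succ', linkStates_zero_right, Finset.sum_singleton, h0,
    mul_zero, add_zero, Finset.sum_eq_single 0]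
  · rw [zero_add, Finset.sum_eq_single (oneCup k) (key 0)]
    intro hn
    exact absurd (mem_linkStates.mpr (isLinkState_oneCup hk)) hn
  · intro p _ hp
    obtain ⟨p, rfl⟩ := Nat.exists_eq_succ_of_ne_zero hp
    rw [Finset.sum_eq_zero, mul_zero]
    intro m hm
    refine key _ m hm ?_
    rintro rfl
    have h1 := (mem_linkStates.mp hm).card
    rw [(isLinkState_oneCup hk).card] at h1
    omega
  · intro hn
    rw [Finset.mem_range, not_lt] at hn
    omega

/-! ### Action on the link states with at most one cup -/

theorem actE_noCup (δ : ℝ) (i : ℕ) : actE δ i (Finsupp.single noCup 1) = 0 := by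
  rw [actE_single, actOn_zero _ _ _ ⟨rfl, rfl⟩, smul_zero]

theorem actE_oneCup_far (δ : ℝ) {i j : ℕ} (h : i + 1 < j ∨ j + 1 < i) :
    actE δ i (Finsupp.single (oneCup j) 1) = 0 := by
  rw [actE_single, actOn_zero, smul_zero]
  rw [oneCup_apply, oneCup_apply]
  grind

theorem actE_oneCup_near (δ : ℝ) {i j : ℕ} (h : i + 1 = j ∨ j + 1 = i) :
    actE δ i (Finsupp.single (oneCup j) 1) = Finsupp.single (oneCup i) 1 := by
  rw [actE_single, one_smul, actOn_join]
  · congr 1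
    refine Subtype.ext (funext fun k => ?_)
    simp only [join, oneCup_apply]
    grind
  · rw [oneCup_apply, oneCup_apply]
    grind
  · rw [oneCup_apply]
    grind

theorem actE_oneCup_self (δ : ℝ) (i : ℕ) :
    actE δ i (Finsupp.single (oneCup i) 1) = (δ : ℂ) • Finsupp.single (oneCup i) 1 := by
  rw [actE_single, one_smul, actOn_loop _ _ _ (by simp [oneCup_apply]), Finsupp.smul_single,
    smul_eq_mul, mul_one]

/-- The counterpart for vectors of `jwSeq_mul_of_annihilated`: it needs no condition on the quantum
integers. -/
theorem pairingRep_jonesWenzl_of_annihilated (δ : ℝ) (s : ℕ) (v : Pairing →₀ ℂ) :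
    ∀ n, (∀ j, s ≤ j → j + 1 < s + n → actE δ j v = 0) → pairingRep δ (jonesWenzl δ s n) v = v
  | 0, _ => by simp [jonesWenzl]
  | 1, _ => by simp [jonesWenzl]
  | n + 2, H => by
    have ih := pairingRep_jonesWenzl_of_annihilated δ s v (n + 1)
      (fun j h h' => H j h (by omega))
    rw [jonesWenzl, map_sub, map_smul, map_mul, map_mul, LinearMap.sub_apply,
      LinearMap.smul_apply, Module.End.mul_apply, Module.End.mul_apply, ih, pairingRep_e,
      H _ (by omega) (by omega), map_zero, smul_zero, sub_zero]

theorem pairingRep_jonesWenzl_noCup (δ : ℝ) (s n : ℕ) :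
    pairingRep δ (jonesWenzl δ s n) (Finsupp.single noCup 1) = Finsupp.single noCup 1 :=
  pairingRep_jonesWenzl_of_annihilated δ s _ n (fun j _ _ => actE_noCup δ j)

/-- Only the state without cups survives, and the idempotent fixes it. -/
theorem chi_jonesWenzl {δ : ℝ} (γ : ℂ) {n : ℕ} (hq : ∀ k, 0 < k → k ≤ n → qInt δ k ≠ 0) :
    chi δ γ (jonesWenzl δ 0 n) = c0 γ n := by
  have hm := jonesWenzl_mem δ 0 n
  rw [zero_add] at hm
  rw [chi_eq_of_annihilates δ γ hm (fun j hj => jonesWenzl_mul_e hq 0 (by omega) (by omega)),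
    diagEntry, pairingRep_jonesWenzl_noCup, Finsupp.single_eq_same, mul_one]

/-- The entry of `f_{n+1}`, on the strands `0, …, n`, that moves its last cup to the first one. -/
theorem jonesWenzl_oneCup_right {δ : ℝ} :
    ∀ n, (∀ k, 0 < k → k ≤ n + 1 → qInt δ k ≠ 0) →
      pairingRep δ (jonesWenzl δ 0 (n + 1)) (Finsupp.single (oneCup n) 1) (oneCup 0) =
        (-1) ^ n / (qInt δ (n + 1) : ℂ)
  | 0, _ => by simp [jonesWenzl, qInt]
  | n + 1, hq => by
    have ih := jonesWenzl_oneCup_right n (fun k h h' => hq k h (by omega))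
    -- The cup at `n + 1` is out of reach of the shorter idempotent. Only the correction term
    -- contributes, and it multiplies the previous entry by `-[n+1]/[n+2]`.
    have h1 : pairingRep δ (jonesWenzl δ 0 (n + 1)) (Finsupp.single (oneCup (n + 1)) 1) =
        Finsupp.single (oneCup (n + 1)) 1 :=
      pairingRep_jonesWenzl_of_annihilated δ 0 _ _ fun j _ h => actE_oneCup_far δ (by omega)
    have q1 : (qInt δ (n + 1) : ℂ) ≠ 0 := Complex.ofReal_ne_zero.mpr (hq _ (by omega) (by omega))
    have q2 : (qInt δ (n + 2) : ℂ) ≠ 0 := Complex.ofReal_ne_zero.mpr (hq _ (by omega) (by omega))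
    rw [jonesWenzl, map_sub, map_smul, map_mul, map_mul, LinearMap.sub_apply,
      LinearMap.smul_apply, Module.End.mul_apply, Module.End.mul_apply, h1, pairingRep_e,
      zero_add, actE_oneCup_near δ (by omega), Finsupp.sub_apply, Finsupp.smul_apply, ih,
      Finsupp.single_eq_of_ne (oneCup_ne (by omega)), smul_eq_mul, Complex.ofReal_div]
    field_simp
    ring

/-- Linear combinations of the link states with one cup `(j, j + 1)`, where `s ≤ j < t`. -/
noncomputable def oneCupSpan (s t : ℕ) : Submodule ℂ (Pairing →₀ ℂ) :=
  Submodule.span ℂ ((fun j => Finsupp.single (oneCup j) 1) '' Set.Ico s t)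

theorem single_mem_oneCupSpan {s t j : ℕ} (h1 : s ≤ j) (h2 : j < t) :
    (Finsupp.single (oneCup j) 1 : Pairing →₀ ℂ) ∈ oneCupSpan s t :=
  Submodule.subset_span ⟨j, ⟨h1, h2⟩, rfl⟩

theorem oneCupSpan_apply_eq_zero {s t j : ℕ} (h : j < s ∨ t ≤ j) {v : Pairing →₀ ℂ}
    (hv : v ∈ oneCupSpan s t) : v (oneCup j) = 0 := by
  induction hv using Submodule.span_induction with
  | mem x hx =>
    obtain ⟨i, ⟨h1, h2⟩, rfl⟩ := hx
    exact Finsupp.single_eq_of_ne (oneCup_ne (by omega))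
  | zero => rfl
  | add x y _ _ hx hy => rw [Finsupp.add_apply, hx, hy, add_zero]
  | smul c x _ hx => rw [Finsupp.smul_apply, hx, smul_zero]

/-- A generator at the right border only sees the last cup. -/
theorem actE_oneCupSpan (δ : ℝ) {s t : ℕ} {v : Pairing →₀ ℂ} (hv : v ∈ oneCupSpan s (t + 1)) :
    actE δ (t + 1) v = v (oneCup t) • Finsupp.single (oneCup (t + 1)) 1 := by
  induction hv using Submodule.span_induction with
  | mem x hx =>
    obtain ⟨i, ⟨h1, h2⟩, rfl⟩ := hx
    by_cases h : i = t
    · subst h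
      rw [actE_oneCup_near δ (by omega), Finsupp.single_eq_same, one_smul]
    · simp only [actE_oneCup_far δ (show t + 1 + 1 < i ∨ i + 1 < t + 1 by omega)]
      rw [Finsupp.single_eq_of_ne (oneCup_ne (by omega)), zero_smul]
  | zero => simp
  | add x y _ _ hx hy => rw [map_add, hx, hy, Finsupp.add_apply, add_smul]
  | smul c x _ hx => rw [map_smul, hx, Finsupp.smul_apply, smul_eq_mul, mul_smul]

/-- A generator `e_i` sends a single cup to zero or to a multiple of the cup at `i`. -/
theorem actE_mem_oneCupSpan (δ : ℝ) {s t i : ℕ} (h1 : s ≤ i) (h2 : i < t) {v : Pairing →₀ ℂ}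
    (hv : v ∈ oneCupSpan s t) : actE δ i v ∈ oneCupSpan s t := by
  induction hv using Submodule.span_induction with
  | mem x hx =>
    obtain ⟨j, ⟨h3, h4⟩, rfl⟩ := hx
    by_cases h : j = i
    · subst h
      simp only [actE_oneCup_self]
      exact Submodule.smul_mem _ _ (single_mem_oneCupSpan h1 h2)
    by_cases h' : i + 1 = j ∨ j + 1 = i
    · simp only [actE_oneCup_near δ h']
      exact single_mem_oneCupSpan h1 h2
    · simp only [actE_oneCup_far δ (show i + 1 < j ∨ j + 1 < i by omega)]
      exact zero_mem _
  | zero => rw [map_zero]; exact zero_mem _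
  | add x y _ _ hx hy => rw [map_add]; exact add_mem hx hy
  | smul c x _ hx => rw [map_smul]; exact Submodule.smul_mem _ _ hx

theorem pairingRep_jonesWenzl_mem_oneCupSpan (δ : ℝ) {s' s t : ℕ} (hs : s' ≤ s)
    {v : Pairing →₀ ℂ} (hv : v ∈ oneCupSpan s' t) :
    ∀ n, s + n ≤ t + 1 → pairingRep δ (jonesWenzl δ s n) v ∈ oneCupSpan s' t
  | 0, _ => by simpa [jonesWenzl] using hv
  | 1, _ => by simpa [jonesWenzl] using hv
  | n + 2, h => by
    have ih := fun (w : Pairing →₀ ℂ) (hw : w ∈ oneCupSpan s' t) =>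
      pairingRep_jonesWenzl_mem_oneCupSpan δ hs hw (n + 1) (by omega)
    rw [jonesWenzl, map_sub, map_smul, map_mul, map_mul, LinearMap.sub_apply,
      LinearMap.smul_apply, Module.End.mul_apply, Module.End.mul_apply, pairingRep_e]
    exact sub_mem (ih v hv) (Submodule.smul_mem _ _
      (ih _ (actE_mem_oneCupSpan δ (by omega) (by omega) (ih v hv))))

/-- A Jones-Wenzl element does not change the coefficient at a cup at its right border. -/
theorem jonesWenzl_oneCup_apply_self (δ : ℝ) {s t : ℕ} :
    ∀ n, s + n ≤ t + 1 →
      pairingRep δ (jonesWenzl δ s n) (Finsupp.single (oneCup t) 1) (oneCup t) = 1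
  | 0, _ => by simp [jonesWenzl]
  | 1, _ => by simp [jonesWenzl]
  | n + 2, h => by
    have h1 : pairingRep δ (jonesWenzl δ s (n + 1)) (Finsupp.single (oneCup t) 1) =
        Finsupp.single (oneCup t) 1 :=
      pairingRep_jonesWenzl_of_annihilated δ s _ _ fun j _ h' => actE_oneCup_far δ (by omega)
    -- The correction term only produces cups strictly to the left of `t`, so it does not touch the
    -- coefficient at `t`.
    have h2 : pairingRep δ (jonesWenzl δ s (n + 1)) (actE δ (s + n) (Finsupp.single (oneCup t) 1))
        ∈ oneCupSpan s t := by
      refine pairingRep_jonesWenzl_mem_oneCupSpan δ le_rfl ?_ _ (by omega)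
      by_cases h' : s + n + 1 = t
      · rw [actE_oneCup_near δ (Or.inl h')]
        exact single_mem_oneCupSpan (by omega) (by omega)
      · rw [actE_oneCup_far δ (by omega)]
        exact zero_mem _
    rw [jonesWenzl, map_sub, map_smul, map_mul, map_mul, LinearMap.sub_apply,
      LinearMap.smul_apply, Module.End.mul_apply, Module.End.mul_apply, h1, pairingRep_e,
      Finsupp.sub_apply, Finsupp.smul_apply, oneCupSpan_apply_eq_zero (by omega) h2, smul_zero,
      sub_zero, Finsupp.single_eq_same]

/-- The entry of `f_{n+1}`, on the strands `s + 1, …, s + n + 1`, that moves its first cup to the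
last one. -/
theorem jonesWenzl_oneCup_left {δ : ℝ} (s : ℕ) :
    ∀ n, (∀ k, 0 < k → k ≤ n + 1 → qInt δ k ≠ 0) →
      pairingRep δ (jonesWenzl δ (s + 1) (n + 1)) (Finsupp.single (oneCup s) 1) (oneCup (s + n)) =
        (-1) ^ n / (qInt δ (n + 1) : ℂ)
  | 0, _ => by simp [jonesWenzl, qInt]
  | n + 1, hq => by
    have ih := jonesWenzl_oneCup_left s n (fun k h h' => hq k h (by omega))
    -- The recursion grows on the right while the cup starts on the left, so the image is not a
    -- single state. The new generator `e δ (s + n + 1)` sees only its coefficient at `oneCup (s +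
    -- n)`, which is the induction hypothesis.
    have h1 : pairingRep δ (jonesWenzl δ (s + 1) (n + 1)) (Finsupp.single (oneCup s) 1) ∈
        oneCupSpan s (s + n + 1) :=
      pairingRep_jonesWenzl_mem_oneCupSpan δ (Nat.le_succ s)
        (single_mem_oneCupSpan le_rfl (by omega)) _ (by omega)
    have q1 : (qInt δ (n + 1) : ℂ) ≠ 0 := Complex.ofReal_ne_zero.mpr (hq _ (by omega) (by omega))
    have q2 : (qInt δ (n + 2) : ℂ) ≠ 0 := Complex.ofReal_ne_zero.mpr (hq _ (by omega) (by omega))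
    have h2 := actE_oneCupSpan δ h1
    rw [ih] at h2
    -- The outer idempotent in the correction keeps the coefficient of the newly made last cup.
    have h3 := jonesWenzl_oneCup_apply_self δ (s := s + 1) (t := s + n + 1) (n + 1) (by omega)
    rw [jonesWenzl, map_sub, map_smul, map_mul, map_mul, LinearMap.sub_apply,
      LinearMap.smul_apply, Module.End.mul_apply, Module.End.mul_apply, pairingRep_e,
      show s + 1 + n = s + n + 1 by omega, show s + (n + 1) = s + n + 1 by omega, h2, map_smul,
      Finsupp.sub_apply, Finsupp.smul_apply, Finsupp.smul_apply, h3,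
      oneCupSpan_apply_eq_zero (by omega) h1, smul_eq_mul, smul_eq_mul, Complex.ofReal_div]
    field_simp
    ring

theorem star_ascending_noCup (δ : ℝ) (k : ℕ) :
    pairingRep δ (star (ascending δ (k + 1))) (Finsupp.single noCup 1) = 0 := by
  obtain ⟨b, hb⟩ := exists_ascending_eq δ k
  rw [hb, star_mul, star_e, map_mul, Module.End.mul_apply, pairingRep_e, actE_noCup, map_zero]

/-- Each factor pushes the cup one place to the right without closing a loop, so no power of `δ`
appears. -/
theorem star_ascending_oneCup (δ : ℝ) :
    ∀ k, pairingRep δ (star (ascending δ k)) (Finsupp.single (oneCup 0) 1) =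
      Finsupp.single (oneCup k) 1
  | 0 => by rw [ascending_zero, star_one, map_one, Module.End.one_apply]
  | k + 1 => by
    rw [ascending_succ, star_mul, star_e, map_mul, Module.End.mul_apply,
      star_ascending_oneCup δ k, pairingRep_e, actE_oneCup_near δ (by omega)]

theorem ascending_oneCup (δ : ℝ) :
    ∀ k, pairingRep δ (ascending δ k) (Finsupp.single (oneCup (k + 1)) 1) =
      Finsupp.single (oneCup 1) 1
  | 0 => by rw [ascending_zero, map_one, Module.End.one_apply]
  | k + 1 => by
    rw [ascending_succ, map_mul, Module.End.mul_apply, pairingRep_e,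
      actE_oneCup_near δ (by omega), ascending_oneCup δ k]

/-! ### Norms of the null vectors -/

theorem witnessX_eq (δ : ℝ) (n : ℕ) : witnessX δ (n + 2) = jonesWenzl δ 0 (n + 1) * e δ n := rfl

theorem witnessY_eq (δ : ℝ) (n : ℕ) :
    witnessY δ (n + 2) = jonesWenzl δ 2 (n + 1) * ascending δ (n + 1) := rfl

theorem form_add_add (δ : ℝ) (γ : ℂ) (x y : TLInf δ) :
    form δ γ (x + y) (x + y) =
      form δ γ x x + form δ γ y y + (form δ γ x y + form δ γ y x) := by
  simp only [form, star_add, mul_add, add_mul, map_add]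
  ring

section Witnesses

variable {δ : ℝ} {n : ℕ} (hq : ∀ k, 0 < k → k ≤ n + 1 → qInt δ k ≠ 0) (h0 : qInt δ (n + 2) = 0)
include hq h0

/-- The trace property replaces `x x^*` by `x^* x = e_{l-1} f_{l-1} e_{l-1}`, a partial trace with
factor `[l]/[l-1] = 0`. -/
theorem form_witnessX_self (γ : ℂ) :
    form δ γ (witnessX δ (n + 2)) (witnessX δ (n + 2)) = 0 := by
  have h := e_mul_jonesWenzl_mul_e_right hq h0 0
  rw [zero_add] at h
  rw [form, chi_mul_comm, witnessX_eq, star_mul, star_e, star_jonesWenzl, mul_assoc,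
    ← mul_assoc (jonesWenzl δ 0 (n + 1)), jonesWenzl_mul_self hq, ← mul_assoc, h, map_zero]

/-- The starred product ends in `e_2`, so the left partial trace `e_2 (1 ⊗ 1 ⊗ f_{l-1}) e_2 = 0`
occurs. It serves both for `‖y‖²` and for the mixed term. -/
theorem star_ascending_mul_jonesWenzl_mul_e :
    star (ascending δ (n + 1)) * jonesWenzl δ 2 (n + 1) * e δ 1 = 0 := by
  obtain ⟨b, hb⟩ := exists_ascending_eq δ n
  rw [hb, star_mul, star_e, mul_assoc, mul_assoc, ← mul_assoc (e δ 1),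
    e_mul_jonesWenzl_mul_e_left hq h0 1, mul_zero]

theorem form_witnessY_self (γ : ℂ) :
    form δ γ (witnessY δ (n + 2)) (witnessY δ (n + 2)) = 0 := by
  obtain ⟨b, hb⟩ := exists_ascending_eq δ n
  rw [form, chi_mul_comm, witnessY_eq, star_mul, star_jonesWenzl, mul_assoc,
    ← mul_assoc (jonesWenzl δ 2 (n + 1)), jonesWenzl_mul_self hq]
  conv_lhs => arg 2; arg 2; rw [hb]
  rw [← mul_assoc, ← mul_assoc, star_ascending_mul_jonesWenzl_mul_e hq h0, zero_mul, map_zero]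

/-- On the right, `x y^*` is killed by `e_3, …, e_l` through the idempotent and by `e_2` through its
partial trace; only `e_1` is left. -/
theorem form_witnessX_witnessY (γ : ℂ) :
    form δ γ (witnessX δ (n + 2)) (witnessY δ (n + 2)) =
      coeff γ (n + 3) 1 * ((-1) ^ n / (qInt δ (n + 1) : ℂ)) := by
  have hm : witnessX δ (n + 2) * star (witnessY δ (n + 2)) ∈ TLn δ (n + 3) := by
    rw [witnessX_eq, witnessY_eq]
    refine mul_mem (mul_mem (TLn_mono δ (by omega) (jonesWenzl_mem δ 0 (n + 1)))
      (e_mem δ (by omega))) (star_mem_TLn (mul_mem (TLn_mono δ (by omega)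
        (jonesWenzl_mem δ 2 (n + 1))) (ascending_mem δ (n + 1))))
  have hr : ∀ v, pairingRep δ (witnessX δ (n + 2) * star (witnessY δ (n + 2))) v =
      pairingRep δ (jonesWenzl δ 0 (n + 1)) (actE δ n (pairingRep δ (star (ascending δ (n + 1)))
        (pairingRep δ (jonesWenzl δ 2 (n + 1)) v))) := by
    intro v
    simp only [witnessX_eq, witnessY_eq, star_mul, star_jonesWenzl, map_mul, Module.End.mul_apply,
      pairingRep_e]
  rw [form, chi_eq_of_annihilates_ne δ γ (k := 0) hm (by omega) (Or.inl rfl)]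
  · rw [diagEntry, hr, pairingRep_jonesWenzl_of_annihilated δ 2, star_ascending_oneCup,
      actE_oneCup_near δ (Or.inl rfl), jonesWenzl_oneCup_right n hq]
    exact fun j hj _ => actE_oneCup_far δ (by omega)
  · intro j hj hj0
    rw [witnessY_eq, star_mul, star_jonesWenzl, mul_assoc]
    rcases Nat.lt_or_ge j 2 with h | h
    · obtain rfl : j = 1 := by omega
      rw [star_ascending_mul_jonesWenzl_mul_e hq h0, mul_zero]
    · rw [mul_assoc, jonesWenzl_mul_e hq 2 h (by omega), mul_zero, mul_zero]
  · rw [diagEntry, hr, pairingRep_jonesWenzl_noCup, star_ascending_noCup, map_zero, map_zero,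
      Finsupp.zero_apply]

/-- For complex `γ` Hermitian symmetry is not available, so this term is computed on its own. The
surviving generator is now `e_l`, at the right border. -/
theorem form_witnessY_witnessX (γ : ℂ) :
    form δ γ (witnessY δ (n + 2)) (witnessX δ (n + 2)) =
      coeff γ (n + 3) 1 * ((-1) ^ n / (qInt δ (n + 1) : ℂ)) := by
  have hm : witnessY δ (n + 2) * star (witnessX δ (n + 2)) ∈ TLn δ (n + 3) := by
    rw [witnessX_eq, witnessY_eq]
    refine mul_mem (mul_mem (TLn_mono δ (by omega) (jonesWenzl_mem δ 2 (n + 1)))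
      (ascending_mem δ (n + 1))) (star_mem_TLn (mul_mem (TLn_mono δ (by omega)
        (jonesWenzl_mem δ 0 (n + 1))) (e_mem δ (by omega))))
  have hr : ∀ v, pairingRep δ (witnessY δ (n + 2) * star (witnessX δ (n + 2))) v =
      pairingRep δ (jonesWenzl δ 2 (n + 1)) (pairingRep δ (ascending δ (n + 1))
        (actE δ n (pairingRep δ (jonesWenzl δ 0 (n + 1)) v))) := by
    intro v
    simp only [witnessX_eq, witnessY_eq, star_mul, star_jonesWenzl, star_e, map_mul,
      Module.End.mul_apply, pairingRep_e]
  rw [form, chi_eq_of_annihilates_ne δ γ (k := n + 1) hm (by omega) (Or.inr rfl)]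
  · rw [diagEntry, hr, pairingRep_jonesWenzl_of_annihilated δ 0, actE_oneCup_near δ (Or.inl rfl),
      ascending_succ, map_mul, Module.End.mul_apply, pairingRep_e,
      actE_oneCup_near δ (Or.inr rfl), ascending_oneCup]
    · have h := jonesWenzl_oneCup_left 1 n hq
      rw [add_comm 1 n] at h
      rw [h]
    exact fun j _ hj => actE_oneCup_far δ (by omega)
  · intro j hj hj0
    rw [witnessX_eq, star_mul, star_e, star_jonesWenzl, mul_assoc, mul_assoc]
    rcases Nat.lt_or_ge j n with h | h
    · rw [jonesWenzl_mul_e hq 0 (Nat.zero_le j) (by omega), mul_zero, mul_zero]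
    · obtain rfl : j = n := by omega
      have h := e_mul_jonesWenzl_mul_e_right hq h0 0
      rw [zero_add, mul_assoc] at h
      rw [h, mul_zero]
  · rw [diagEntry, hr, pairingRep_jonesWenzl_noCup, actE_noCup, map_zero, map_zero,
      Finsupp.zero_apply]

theorem form_witness_add (γ : ℂ) :
    form δ γ (witnessX δ (n + 2) + witnessY δ (n + 2)) (witnessX δ (n + 2) + witnessY δ (n + 2)) =
      2 * (-1) ^ (n + 2) * coeff γ (n + 3) 1 / (qInt δ (n + 1) : ℂ) := by
  rw [form_add_add, form_witnessX_self hq h0, form_witnessY_self hq h0,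
    form_witnessX_witnessY hq h0, form_witnessY_witnessX hq h0]
  ring

theorem form_witness_add_ne_zero {γ : ℂ} (hγ : γ ≠ 0) (hc : c0 γ (n + 1) ≠ 0) :
    form δ γ (witnessX δ (n + 2) + witnessY δ (n + 2)) (witnessX δ (n + 2) + witnessY δ (n + 2))
      ≠ 0 := by
  have q1 : (qInt δ (n + 1) : ℂ) ≠ 0 := Complex.ofReal_ne_zero.mpr (hq _ (by omega) le_rfl)
  rw [form_witness_add hq h0, coeff, pow_one, show n + 3 - 2 * 1 = n + 1 by omega]
  exact div_ne_zero (mul_ne_zero (mul_ne_zero two_ne_zero (pow_ne_zero _ (by norm_num)))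
    (mul_ne_zero hγ hc)) q1

end Witnesses

/-! ### Vectors of negative norm -/

/-- For `t² r = -1` the vectors `1 ± i t v` are null: `hs` cancels the cross terms and leaves `1 +
t² r`. Their sum is `2`, of norm `4`. -/
theorem isIndefinite_of_neg {δ : ℝ} {γ : ℂ} {v : TLInf δ} {r : ℝ} (hr : r < 0)
    (hv : form δ γ v v = (r : ℂ)) (hs : chi δ γ (star v) = chi δ γ v) :
    IsIndefinite (form δ γ) := by
  refine ⟨⟨0, by simp [form]⟩, fun H => ?_⟩
  have key : ∀ t : ℝ, t ^ 2 * r = -1 →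
      form δ γ (1 + (Complex.I * t) • v) (1 + (Complex.I * t) • v) = 0 := by
    intro t ht
    have ht' : (t : ℂ) ^ 2 * (r : ℂ) = -1 := by exact_mod_cast ht
    unfold form at hv ⊢
    simp only [star_add, star_one, star_smul, mul_add, add_mul, one_mul, mul_one, map_add,
      map_smul, smul_mul_assoc, mul_smul_comm, hv, hs, chi_one, smul_eq_mul, RCLike.star_def,
      map_mul, Complex.conj_I, Complex.conj_ofReal]
    linear_combination ht' - (t : ℂ) ^ 2 * r * Complex.I_sq
  have ht : (√(-r))⁻¹ ^ 2 * r = -1 := by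
    rw [inv_pow, Real.sq_sqrt (by linarith), inv_neg, neg_mul, inv_mul_cancel₀ hr.ne]
  have h := H _ _ (key _ ht) (key (-(√(-r))⁻¹) (by rw [neg_sq]; exact ht))
  have he : (1 + (Complex.I * (((√(-r))⁻¹ : ℝ) : ℂ)) • v) +
      (1 + (Complex.I * ((-(√(-r))⁻¹ : ℝ) : ℂ)) • v) = (2 : ℂ) • (1 : TLInf δ) := by
    rw [add_add_add_comm, ← add_smul, Complex.ofReal_neg, mul_neg, add_neg_cancel, zero_smul,
      add_zero, two_smul]
  rw [he, form, star_smul, star_one, smul_mul_smul_comm, mul_one, map_smul, chi_one] at h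
  norm_num at h

theorem form_jonesWenzl {δ : ℝ} (γ : ℂ) {n : ℕ} (hq : ∀ k, 0 < k → k ≤ n → qInt δ k ≠ 0) :
    form δ γ (jonesWenzl δ 0 n) (jonesWenzl δ 0 n) = c0 γ n := by
  rw [form, star_jonesWenzl, jonesWenzl_mul_self hq, chi_jonesWenzl γ hq]

/-- Up to the factor `δ`, the norm is the trace of the correction term in the Jones-Wenzl recursion.
Comparison with `c_{n+2,0} = c_{n+1,0} - γ c_{n,0}` determines it. -/
theorem form_jonesWenzl_mul_e {δ : ℝ} (γ : ℂ) {n : ℕ}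
    (hq : ∀ k, 0 < k → k ≤ n + 2 → qInt δ k ≠ 0) :
    form δ γ (jonesWenzl δ 0 (n + 1) * e δ n) (jonesWenzl δ 0 (n + 1) * e δ n) =
      ((δ * (qInt δ (n + 2) / qInt δ (n + 1)) : ℝ) : ℂ) * (γ * c0 γ n) := by
  have q1 : (qInt δ (n + 1) : ℂ) ≠ 0 := Complex.ofReal_ne_zero.mpr (hq _ (by omega) (by omega))
  have q2 : (qInt δ (n + 2) : ℂ) ≠ 0 := Complex.ofReal_ne_zero.mpr (hq _ (by omega) (by omega))
  have h1 := chi_jonesWenzl γ (δ := δ) (n := n + 1) (fun k h h' => hq k h (by omega))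
  have h2 := chi_jonesWenzl γ hq
  rw [jonesWenzl, map_sub, map_smul, h1, c0, zero_add, smul_eq_mul] at h2
  have h3 : jonesWenzl δ 0 (n + 1) * e δ n * star (jonesWenzl δ 0 (n + 1) * e δ n) =
      (δ : ℂ) • (jonesWenzl δ 0 (n + 1) * e δ n * jonesWenzl δ 0 (n + 1)) := by
    rw [star_mul, star_e, star_jonesWenzl, mul_assoc, ← mul_assoc (e δ n), e_sq, smul_mul_assoc,
      mul_smul_comm, ← mul_assoc]
  rw [form, h3, map_smul, smul_eq_mul]
  have h4 : ((qInt δ (n + 1) / qInt δ (n + 2) : ℝ) : ℂ) *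
      chi δ γ (jonesWenzl δ 0 (n + 1) * e δ n * jonesWenzl δ 0 (n + 1)) = γ * c0 γ n := by
    linear_combination -h2
  rw [← h4]
  push_cast
  field_simp

/-! ### Quantum integers -/

/-- The quantum integers at a complex parameter. -/
noncomputable def qIntC (z : ℂ) : ℕ → ℂ
  | 0 => 0
  | 1 => 1
  | k + 2 => z * qIntC z (k + 1) - qIntC z k

theorem qIntC_ofReal (x : ℝ) : ∀ n, qIntC (x : ℂ) n = (qInt x n : ℂ)
  | 0 => by simp [qIntC, qInt]
  | 1 => by simp [qIntC, qInt]
  | n + 2 => by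
    rw [qIntC, qInt, qIntC_ofReal x n, qIntC_ofReal x (n + 1)]
    push_cast
    rfl

theorem qIntC_conj (z : ℂ) : ∀ n, qIntC (starRingEnd ℂ z) n = starRingEnd ℂ (qIntC z n)
  | 0 => by simp [qIntC]
  | 1 => by simp [qIntC]
  | n + 2 => by
    rw [qIntC, qIntC, qIntC_conj z n, qIntC_conj z (n + 1), map_sub, map_mul]

/-- The Christoffel-Darboux identity for the quantum integers. -/
theorem sub_mul_sum_qIntC (z w : ℂ) (N : ℕ) :
    (z - w) * ∑ i ∈ Finset.range (N + 1), qIntC z i * qIntC w i =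
      qIntC z (N + 1) * qIntC w N - qIntC z N * qIntC w (N + 1) := by
  induction N with
  | zero => simp [qIntC]
  | succ N ih =>
    rw [Finset.sum_range_succ, mul_add, ih, qIntC, qIntC]
    ring

theorem sub_mul_qIntC {q z : ℂ} (h0 : q ≠ 0) (hz : z = q + q⁻¹) :
    ∀ n, (q - q⁻¹) * qIntC z n = q ^ n - (q⁻¹) ^ n
  | 0 => by simp [qIntC]
  | 1 => by simp [qIntC]
  | n + 2 => by
    have h1 := sub_mul_qIntC h0 hz n
    have h2 := sub_mul_qIntC h0 hz (n + 1)
    have h3 : q * q⁻¹ = 1 := mul_inv_cancel₀ h0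
    rw [qIntC, mul_sub, h1, mul_left_comm, h2, hz]
    linear_combination (q ^ n - (q⁻¹) ^ n) * h3

/-- From `(q - q⁻¹)[n] = q^n - q⁻ⁿ`; the condition `q² ≠ 1` makes the factor nonzero. -/
theorem qInt_eq_zero_iff {q : ℂ} {δ : ℝ} (hδ : (δ : ℂ) = q + q⁻¹) (h0 : q ≠ 0)
    (h2 : q ^ 2 ≠ 1) (n : ℕ) : qInt δ n = 0 ↔ q ^ (2 * n) = 1 := by
  have h := sub_mul_qIntC h0 hδ n
  have h3 : q - q⁻¹ ≠ 0 := by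
    intro h4
    apply h2
    rw [sq]
    nth_rewrite 2 [sub_eq_zero.mp h4]
    exact mul_inv_cancel₀ h0
  have hn : q ^ n ≠ 0 := pow_ne_zero n h0
  rw [← Complex.ofReal_eq_zero, ← qIntC_ofReal, two_mul, pow_add, ← mul_right_inj' h3, h, mul_zero,
    sub_eq_zero, inv_pow, ← mul_inv_eq_one₀ (inv_ne_zero hn), inv_inv]

/-! ### Zeros and positivity of the coefficients `c_{n,0}` -/

/-- With `γ = z⁻²`, rescaling by `z^n` turns the recursion of `c_{n,0}` into that of the quantum
integers at `z`. -/
theorem c0_mul_pow {z γ : ℂ} (h : z ^ 2 * γ = 1) : ∀ n, c0 γ n * z ^ n = qIntC z (n + 1)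
  | 0 => by simp [c0, qIntC]
  | 1 => by simp [c0, qIntC]
  | n + 2 => by
    rw [qIntC, ← c0_mul_pow h (n + 1), ← c0_mul_pow h n, c0]
    linear_combination -(c0 γ n * z ^ n) * h

/-- The zeros of the polynomials `c_{n,0}` are real: they have the form `z⁻²`. -/
theorem exists_real_of_c0_eq_zero {γ : ℂ} (hγ : γ ≠ 0) {N : ℕ} (hN : 0 < N) (h0 : c0 γ N = 0) :
    ∃ z : ℝ, 0 < z ∧ (z : ℂ) ^ 2 * γ = 1 := by
  obtain ⟨z, hz⟩ := IsAlgClosed.exists_pow_nat_eq (γ⁻¹) (n := 2) two_pos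
  have hz1 : z ^ 2 * γ = 1 := by rw [hz, inv_mul_cancel₀ hγ]
  have hq : qIntC z (N + 1) = 0 := by rw [← c0_mul_pow hz1, h0, zero_mul]
  -- The right side vanishes, so `z - z̄` times a sum of squared moduli is zero. The term `[1] = 1`
  -- makes the sum positive, hence `z` is real.
  have hw := sub_mul_sum_qIntC z (starRingEnd ℂ z) N
  simp only [qIntC_conj, hq, map_zero, zero_mul, mul_zero, sub_zero, Complex.mul_conj] at hw
  have hpos : 0 < ∑ i ∈ Finset.range (N + 1), Complex.normSq (qIntC z i) :=
    Finset.sum_pos' (fun i _ => Complex.normSq_nonneg _)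
      ⟨1, Finset.mem_range.mpr (by omega), by simp [qIntC]⟩
  rw [← Complex.ofReal_sum, mul_eq_zero, or_iff_left (Complex.ofReal_ne_zero.mpr hpos.ne'),
    sub_eq_zero] at hw
  obtain ⟨x, rfl⟩ := Complex.conj_eq_iff_real.mp hw.symm
  have hx : x ≠ 0 := by
    rintro rfl
    simp at hz1
  exact ⟨|x|, abs_pos.mpr hx, by rw [← Complex.ofReal_pow, sq_abs, Complex.ofReal_pow, hz1]⟩

/-- The bound `c_{n+1,0} ≥ c_{n,0} / 2 > 0` propagates, because `r c_{n,0} ≤ c_{n,0} / 4 ≤ c_{n+1,0}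
/ 2`. -/
theorem c0_ne_zero_of_le {r : ℝ} (h1 : r ≤ 1 / 4) (n : ℕ) : c0 (r : ℂ) n ≠ 0 := by
  have key : ∀ n, ∃ x y : ℝ, c0 (r : ℂ) n = x ∧ c0 (r : ℂ) (n + 1) = y ∧ 0 < x ∧ x ≤ 2 * y := by
    intro n
    induction n with
    | zero => exact ⟨1, 1, by simp [c0], by simp [c0], by norm_num, by norm_num⟩
    | succ n ih =>
      obtain ⟨x, y, hx, hy, h2, h3⟩ := ih
      refine ⟨y, y - r * x, hy, ?_, by linarith, ?_⟩
      · rw [c0, hx, hy]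
        push_cast
        rfl
      · have := mul_le_mul_of_nonneg_right h1 h2.le
        linarith
  obtain ⟨x, y, hx, -, h2, -⟩ := key n
  rw [hx]
  exact Complex.ofReal_ne_zero.mpr h2.ne'

/-! ### Indefiniteness when the witnesses have a null sum -/

/-- The form is indefinite if `c_{n+1,0} = 0`, unless `γ = δ⁻²`. -/
theorem isIndefinite_of_c0_eq_zero {δ : ℝ} (hδ : 0 ≤ δ) {γ : ℂ} (hγ : γ ≠ 0)
    (hγδ : (δ : ℂ) ^ 2 * γ ≠ 1) {n : ℕ} (hq : ∀ k, 0 < k → k ≤ n + 1 → qInt δ k ≠ 0)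
    (h0 : qInt δ (n + 2) = 0) (hc : c0 γ (n + 1) = 0) : IsIndefinite (form δ γ) := by
  obtain ⟨z, hz, hzγ⟩ := exists_real_of_c0_eq_zero hγ (Nat.succ_pos n) hc
  have hc0 : ∀ k, c0 γ k = ((qInt z (k + 1) / z ^ k : ℝ) : ℂ) := by
    intro k
    have hzk : (z : ℂ) ^ k ≠ 0 := pow_ne_zero k (Complex.ofReal_ne_zero.mpr hz.ne')
    rw [Complex.ofReal_div, Complex.ofReal_pow, ← qIntC_ofReal, ← c0_mul_pow hzγ,
      mul_div_cancel_right₀ _ hzk]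
  have hγz : γ = (((z ^ 2)⁻¹ : ℝ) : ℂ) := by
    rw [Complex.ofReal_inv, Complex.ofReal_pow]
    exact eq_inv_of_mul_eq_one_right hzγ
  have hz0 : qInt z (n + 2) = 0 := by
    have h := hc0 (n + 1)
    rw [hc, eq_comm, Complex.ofReal_eq_zero, div_eq_zero_iff] at h
    exact h.resolve_right (pow_pos hz _).ne'
  by_contra hind
  -- Otherwise the self-adjoint element `f_k`, with norm `c_{k,0}`, has negative norm.
  have hnonneg : ∀ k, k ≤ n + 1 → 0 ≤ qInt z (k + 1) := by
    intro k hk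
    by_contra hneg
    refine hind (isIndefinite_of_neg (r := qInt z (k + 1) / z ^ k)
      (div_neg_of_neg_of_pos (not_le.mp hneg) (pow_pos hz k)) ?_ ?_ (v := jonesWenzl δ 0 k))
    · rw [form_jonesWenzl γ (fun j h h' => hq j h (by omega)), hc0]
    · rw [star_jonesWenzl]
  have hzpos : ∀ k, k ≤ n → 0 < qInt z (k + 1) := by
    intro k
    induction k with
    | zero => intro _; exact one_pos
    | succ k ih =>
      intro hk
      have h1 := ih (by omega)
      refine lt_of_le_of_ne (hnonneg (k + 1) (by omega)) fun h2 => ?_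
      have h3 := hnonneg (k + 2) (by omega)
      -- A zero right after a positive value would make the next value negative.
      rw [qInt, ← h2, mul_zero, zero_sub] at h3
      linarith
  have hδpos : ∀ k, k ≤ n → 0 < qInt δ (k + 1) := by
    intro k
    induction k with
    | zero => intro _; exact one_pos
    | succ k ih =>
      intro hk
      have h1 := ih (by omega)
      have h2 : 0 < δ := lt_of_le_of_ne hδ (by
        have h := hq 2 (by omega) (by omega)
        simp only [qInt, mul_one, sub_zero] at h
        exact h.symm)
      by_contra hneg
      have h3 : qInt δ (k + 2) < 0 :=
        lt_of_le_of_ne (not_lt.mp hneg) (hq (k + 2) (by omega) (by omega))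
      -- At the first sign change of `[k]_δ` all other factors of this norm are positive, so the
      -- norm is negative.
      refine hind (isIndefinite_of_neg (v := jonesWenzl δ 0 (k + 1) * e δ k)
        (r := δ * (qInt δ (k + 2) / qInt δ (k + 1)) * ((z ^ 2)⁻¹ * (qInt z (k + 1) / z ^ k)))
        ?_ ?_ ?_)
      · refine mul_neg_of_neg_of_pos (mul_neg_of_pos_of_neg h2 (div_neg_of_neg_of_pos h3 h1)) ?_
        have := hzpos k (by omega)
        positivity
      · rw [form_jonesWenzl_mul_e γ (fun j h h' => hq j h (by omega)), hc0 k]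
        conv_lhs => arg 2; arg 1; rw [hγz]
        push_cast
        rfl
      · rw [star_mul, star_e, star_jonesWenzl, chi_mul_comm]
  -- Both `[n+2]_δ` and `[n+2]_z` vanish while the sum is positive, which forces `δ = z`.
  have hw := sub_mul_sum_qIntC (δ : ℂ) (z : ℂ) (n + 1)
  simp only [qIntC_ofReal, h0, hz0, Complex.ofReal_zero, zero_mul, mul_zero, sub_zero,
    ← Complex.ofReal_mul, ← Complex.ofReal_sum, ← Complex.ofReal_sub] at hw
  rw [Complex.ofReal_eq_zero, mul_eq_zero, Finset.sum_range_succ'] at hw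
  have hpos : 0 < ∑ i ∈ Finset.range (n + 1), qInt δ (i + 1) * qInt z (i + 1) :=
    Finset.sum_pos (fun i hi => mul_pos (hδpos i (by rw [Finset.mem_range] at hi; omega))
      (hzpos i (by rw [Finset.mem_range] at hi; omega))) ⟨0, by simp⟩
  rw [show qInt δ 0 = 0 from rfl, zero_mul, add_zero, or_iff_left hpos.ne', sub_eq_zero] at hw
  exact hγδ (hw ▸ hzγ)

end TemperleyLieb

/-! ### The main theorem -/

theorem mainTheorem2 (q : ℂ) (δ : ℝ) (l : ℕ) (hδ : (δ : ℂ) = q + q⁻¹) (hδ0 : 0 ≤ δ)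
    (hl : 2 ≤ l) (hq : q ^ (2 * l) = 1) (hmin : ∀ k : ℕ, 0 < k → k < l → q ^ (2 * k) ≠ 1)
    (γ : ℂ) (hγ0 : γ ≠ 0) (hγ : (δ : ℂ) ^ 2 * γ ≠ 1) :
    TemperleyLieb.IsIndefinite (TemperleyLieb.form δ γ) ∧
    (TemperleyLieb.form δ γ (TemperleyLieb.witnessX δ l) (TemperleyLieb.witnessX δ l) = 0 ∧
      TemperleyLieb.form δ γ (TemperleyLieb.witnessY δ l) (TemperleyLieb.witnessY δ l) = 0 ∧
      TemperleyLieb.form δ γ (TemperleyLieb.witnessX δ l + TemperleyLieb.witnessY δ l)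
          (TemperleyLieb.witnessX δ l + TemperleyLieb.witnessY δ l) =
        2 * (-1) ^ l * TemperleyLieb.coeff γ (l + 1) 1 / (TemperleyLieb.qInt δ (l - 1) : ℂ)) ∧
    (∀ r : ℝ, γ = (r : ℂ) → 0 < r → r ≤ 1 / 4 →
      TemperleyLieb.form δ γ (TemperleyLieb.witnessX δ l + TemperleyLieb.witnessY δ l)
          (TemperleyLieb.witnessX δ l + TemperleyLieb.witnessY δ l) ≠ 0) ∧
    (δ = 0 →
      TemperleyLieb.form δ γ (TemperleyLieb.e δ 0) (TemperleyLieb.e δ 0) = 0 ∧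
      TemperleyLieb.form δ γ (TemperleyLieb.e δ 1) (TemperleyLieb.e δ 1) = 0 ∧
      TemperleyLieb.form δ γ (TemperleyLieb.e δ 0 + TemperleyLieb.e δ 1)
          (TemperleyLieb.e δ 0 + TemperleyLieb.e δ 1) = 2 * γ) := by
  open TemperleyLieb in
  obtain ⟨n, rfl⟩ : ∃ n, l = n + 2 := ⟨l - 2, by omega⟩
  have hq0 : q ≠ 0 := by
    rintro rfl
    rw [zero_pow (by omega)] at hq
    exact zero_ne_one hq
  have hq2 : q ^ 2 ≠ 1 := hmin 1 one_pos (by omega)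
  have hne : ∀ k, 0 < k → k ≤ n + 1 → qInt δ k ≠ 0 := fun k h h' =>
    (qInt_eq_zero_iff hδ hq0 hq2 k).not.mpr (hmin k h (by omega))
  have h0 : qInt δ (n + 2) = 0 := (qInt_eq_zero_iff hδ hq0 hq2 _).mpr hq
  refine ⟨?_, ⟨form_witnessX_self hne h0 γ, form_witnessY_self hne h0 γ,
    form_witness_add hne h0 γ⟩, ?_, ?_⟩
  -- Here `c0 γ (n + 1)` is `c_{l-1,0}`, the factor that decides whether `x + y` is null.
  · by_cases hc : c0 γ (n + 1) = 0
    · exact isIndefinite_of_c0_eq_zero hδ0 hγ0 hγ hne h0 hc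
    · exact ⟨⟨0, by simp [form]⟩, fun H => form_witness_add_ne_zero hne h0 hγ0 hc
        (H _ _ (form_witnessX_self hne h0 γ) (form_witnessY_self hne h0 γ))⟩
  · rintro r rfl - h2
    exact form_witness_add_ne_zero hne h0 hγ0 (c0_ne_zero_of_le h2 _)
  · rintro rfl
    -- For `δ = 0` already `[2] = 0`, so the results for `n = 0` apply; as `f_1 = 1`, the witnesses
    -- are `e_1` and `e_2`.
    have hne' : ∀ k, 0 < k → k ≤ 0 + 1 → qInt 0 k ≠ 0 := by
      intro k h h'
      obtain rfl : k = 1 := by omega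
      exact one_ne_zero
    have h0' : qInt 0 (0 + 2) = 0 := by simp [qInt]
    have hx : witnessX 0 (0 + 2) = e 0 0 := by simp [witnessX, jonesWenzl]
    have hy : witnessY 0 (0 + 2) = e 0 1 := by simp [witnessY, jonesWenzl]
    rw [← hx, ← hy]
    refine ⟨form_witnessX_self hne' h0' γ, form_witnessY_self hne' h0' γ, ?_⟩
    rw [form_witness_add hne' h0']
    simp [coeff, c0, qInt]
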